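/- Model. In the synchronous KT-2 CONGEST model the input graph $G$ on $n$ nodes is the communication network; nodes have distinct IDs from an ordered space of size polynomial in $n$ and know $n$; each node initially knows the IDs of all nodes within distance $2$ and the neighbourhood of every node within distance $1$. In each round a node may send one $O(\log n)$-bit message to each neighbour. Nodes have private randomness (independent uniform elements of $[0,1]$). An algorithm is comparison-based if IDs are only stored, sent in messages and compared with each other; all other local computation is arbitrary, but only on ordinary (non-ID) data, including the results of comparisons. Algorithm, for a constant $c>0$, with $L=(\lfloor\sqrt n\rfloor+1)(\lfloor\log_2 n\rfloor+1)$. A random number below is uniform in $\{0,\dots,n^4-1\}$, and ties are broken by ID. (1) Sampling: each node joins a set $S$ independently with probability $\min(1,c/\sqrt n)$. (2) Parallel randomized greedy MIS on $S$ (rounds $0,\dots,L$): each sampled node sends a random rank to its neighbours; it joins the MIS as soon as it is a local maximum among its undecided neighbours in $S$, and it drops out when a neighbour joins; either is announced to all neighbours. No node joins in the last round of this stage. All other nodes with a neighbour that joined drop out silently. (3) Informing 2-hop neighbours (rounds $L+1,\dots,2L$): for each node $u$ that joined, consider the depth-2 BFS tree of $u$ in which each node at distance two from $u$ is a child of its common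 neighbour with $u$ of lowest ID. Each neighbour of $u$ sends the ID of $u$ to its children in this tree, one message per edge and round. (4) Pruning: nodes that are decided halt; each other node disregards its neighbours that are adjacent to a node that it knows to have joined. The remnant graph is the subgraph of $G$ induced by the nodes undecided at this point. (5) Luby's algorithm on the remnant graph, in phases of three rounds: each remaining node sends a fresh random number to its remaining neighbours; local maxima join the MIS, announce it and halt; nodes with a neighbour that joined announce that they leave and halt. Theorem. For every constant $c>0$ this is a randomized comparison-based algorithm in the KT-2 CONGEST model (all its messages have $O(\log n)$ bits when the ID space has polynomial size). On every graph, for every assignment of distinct IDs and every outcome of the random choices, it terminates, and its output is a maximal independent set. With high probability it sends $O(n^{1.5}\log^2 n)$ messages, all nodes halt within $\tilde O(\sqrt n)$ rounds, and the remnant graph has maximum degree $O(\sqrt n\,\log n)$. Precisely: there is a constant $e$ such that for every $a\ge 1$ there is a constant $K$ such that for every $n\ge 2$, every graph on $n$ nodes and every assignment of distinct IDs, with probability at least $1-n^{-a}$ at most $K n^{1.5}\log^2 n$ messages are sent, all nodes halt within $K\sqrt n\,\log^e n$ rounds, and the remnant graph has maximum degree at most $K\sqrt n\,\log n$. ($e$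 and $K$ may also depend on $c$.) -/

import Mathlib

open MeasureTheory

noncomputable section

/-! ### Comparison-based algorithms in the synchronous KT-`ρ` CONGEST model

The private randomness of a node is a sequence of independent uniform elements of `[0,1]`. A node
never handles the value of an ID: it refers to IDs through the names of its ID-type variables, and
all it learns about their contents is the results of comparisons. -/

/-- The private random tape of a node. -/
abbrev Tape := ℕ → unitInterval

/-- Names of the ID-type variables of a node.
`known i` holds the `i`-th smallest (from `0`) among the initially known IDs;
`received t i p` holds the `p`-th ID in the message that arrived in round `t` from the neighbour
whose ID is held by `known i`. -/
inductive IDVar where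
  | known (i : ℕ)
  | received (t i p : ℕ)

/-- The ordinary part of the initial knowledge of a node: the number of nodes of the network, the
number of initially known IDs, and, in terms of the positions of the IDs in the sorted list of
these, its own ID and the known adjacencies. -/
structure LocalView where
  n : ℕ
  size : ℕ
  self : ℕ
  adj : ℕ → ℕ → Prop

/-- A randomized comparison-based algorithm. In every round `t`, a node that has not halted
* sends to its neighbour `known i` the message `send view tape t state i` (`none`: no message);
  a message consists of an ordinary value and the contents of a list of ID-type variables;
* receives messages: of the message from the neighbour `known i` it gets the ordinary value and
  the number of IDs in it, as `inbox i`, while the IDs are stored in the variables `received t i p`;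
* updates its ordinary state by an arbitrary computation on ordinary data, among which are the
  results `cmp x y` of comparing ID-type variables (`none` if one of them is unassigned).

`output` tells whether the node is in the computed set. -/
structure CompAlgorithm where
  State : Type
  init : (view : LocalView) → (tape : Tape) → State
  send : (view : LocalView) → (tape : Tape) → (t : ℕ) → State → (i : ℕ) →
    Option (ℕ × List IDVar)
  receive : (view : LocalView) → (tape : Tape) → (t : ℕ) →
    (cmp : IDVar → IDVar → Option Ordering) → (inbox : ℕ → Option (ℕ × ℕ)) → State → State
  halted : State → Prop
  output : State → Prop

/-- A network: a graph whose nodes have distinct IDs from the totally ordered ID space `Fin N`. -/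
structure Network (V : Type*) (N : ℕ) where
  graph : SimpleGraph V
  id : V ↪ Fin N

/-- A message: an ordinary value and a list of IDs. -/
structure Message (N : ℕ) where
  ord : ℕ
  ids : List (Fin N)

/-- The length of a message in bits; an ID takes `⌈log₂ N⌉` bits. -/
def Message.bits {N : ℕ} (m : Message N) : ℕ := Nat.size m.ord + m.ids.length * Nat.clog 2 N

namespace Network

variable {V : Type*} [Fintype V] {N : ℕ} (W : Network V N) (ρ : ℕ)

open Classical in
/-- The IDs initially known to `v`, those of the nodes at distance at most `ρ`, in increasing
order. -/
def knownIDs (v : V) : List (Fin N) :=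
  ((Finset.univ.filter fun w => W.graph.edist v w ≤ (ρ : ℕ∞)).image W.id).sort

/-- The position of the ID of `w` in the list of IDs initially known to `v`. -/
def index (v w : V) : ℕ := (W.knownIDs ρ v).idxOf (W.id w)

open Classical in
/-- The node whose ID is the `i`-th one initially known to `v`. -/
def nodeAt (v : V) (i : ℕ) : Option V :=
  if h : ∃ w, (W.knownIDs ρ v)[i]? = some (W.id w) then some h.choose else none

/-- The initial knowledge of `v`: the IDs of all nodes at distance at most `ρ` and the
neighbourhood of every node at distance at most `ρ - 1`. -/
def localView (v : V) : LocalView where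
  n := Fintype.card V
  size := (W.knownIDs ρ v).length
  self := W.index ρ v v
  adj i j := ∃ a b, (W.knownIDs ρ v)[i]? = some (W.id a) ∧ (W.knownIDs ρ v)[j]? = some (W.id b) ∧
    W.graph.Adj a b ∧
      (W.graph.edist v a ≤ ((ρ - 1 : ℕ) : ℕ∞) ∨ W.graph.edist v b ≤ ((ρ - 1 : ℕ) : ℕ∞))

end Network

namespace CompAlgorithm

/-- The local state of a node: the ordinary state and the contents of the ID-type variables. -/
structure NodeConfig (A : CompAlgorithm) (N : ℕ) where
  state : A.State
  var : IDVar → Option (Fin N)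

variable {V : Type*} [Fintype V] {N : ℕ} (A : CompAlgorithm) (W : Network V N) (ρ : ℕ)
  (ω : V × ℕ → unitInterval)

/-- The tape of the node `v`. -/
def tapeOf (ω : V × ℕ → unitInterval) (v : V) : Tape := fun k => ω (v, k)

open Classical in
/-- The message that `v` sends to `w` in round `t`, if any, when the configuration at the beginning
of this round is `C`. -/
def message (C : V → A.NodeConfig N) (t : ℕ) (v w : V) : Option (Message N) :=
  if W.graph.Adj v w ∧ ¬ A.halted (C v).state then
    (A.send (W.localView ρ v) (tapeOf ω v) t (C v).state (W.index ρ v w)).map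
      fun m => ⟨m.1, m.2.filterMap (C v).var⟩
  else none

/-- The message that `v` receives in round `t` from its neighbour `known i`. -/
def inbox (C : V → A.NodeConfig N) (t : ℕ) (v : V) (i : ℕ) : Option (Message N) :=
  (W.nodeAt ρ v i).bind fun u => A.message W ρ ω C t u v

/-- The contents of the ID-type variables of `v` after round `t`. -/
def updateVars (C : V → A.NodeConfig N) (t : ℕ) (v : V) : IDVar → Option (Fin N)
  | .known i => (C v).var (.known i)
  | .received s i p =>
      if s = t then (A.inbox W ρ ω C t v i).bind fun m => m.ids[p]?
      else (C v).var (.received s i p)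

/-- Comparison of two ID-type variables. -/
def compareVars (var : IDVar → Option (Fin N)) (x y : IDVar) : Option Ordering :=
  (var x).bind fun a => (var y).map fun b => compare a b

open Classical in
/-- The configuration after round `t`. -/
def nextConfig (C : V → A.NodeConfig N) (t : ℕ) (v : V) : A.NodeConfig N :=
  if A.halted (C v).state then C v
  else
    { state := A.receive (W.localView ρ v) (tapeOf ω v) t
        (compareVars (A.updateVars W ρ ω C t v))
        (fun i => (A.inbox W ρ ω C t v i).map fun m => (m.ord, m.ids.length))
        (C v).state
      var := A.updateVars W ρ ω C t v }

/-- The configuration at the beginning of round `t` (rounds are numbered from `0`). -/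
def config : ℕ → V → A.NodeConfig N
  | 0 => fun v =>
      { state := A.init (W.localView ρ v) (tapeOf ω v)
        var := fun x => match x with
          | .known i => (W.knownIDs ρ v)[i]?
          | .received _ _ _ => none }
  | t + 1 => A.nextConfig W ρ ω (config t) t

/-- The message that `v` sends to `w` in round `t` of the execution, if any. -/
def sent (t : ℕ) (v w : V) : Option (Message N) :=
  A.message W ρ ω (A.config W ρ ω t) t v w

/-- All nodes have halted after the first `T` rounds. -/
def HaltedBy (T : ℕ) : Prop := ∀ v, A.halted (A.config W ρ ω T v).state

/-- The number of messages that are sent in the first `T` rounds. -/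
def messageCount (T : ℕ) : ℕ :=
  ∑ t ∈ Finset.range T, {p : V × V | (A.sent W ρ ω t p.1 p.2).isSome}.ncard

/-- The set computed after `T` rounds. -/
def outputSet (T : ℕ) : Set V := {v | A.output (A.config W ρ ω T v).state}

end CompAlgorithm

/-- The distribution of the private random tapes: all entries are independent and uniform. -/
def tapeMeasure (V : Type*) : Measure (V × ℕ → unitInterval) :=
  Measure.infinitePi fun _ => volume

/-! ### The MIS algorithm

With `L = (⌊√n⌋ + 1)(⌊log₂ n⌋ + 1)`, the schedule is
* rounds `0, …, L`: parallel randomized greedy MIS on the sampled nodes;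
* rounds `L + 1, …, 2L`: 2-hop neighbours are informed along the local BFS trees;
* rounds `2L + 1, 2L + 2, …`: Luby's algorithm on the remnant graph, three rounds per phase. -/

namespace KT2MIS

/-- The ordinary state of a node. Nodes are named by the positions of their IDs. -/
structure MISState where
  /-- `some true`: in the MIS; `some false`: has a neighbour in the MIS; `none`: undecided -/
  decided : Option Bool
  /-- the node has to announce its decision during the greedy stage -/
  announce : Prop
  /-- sampled neighbours whose decision has not been heard of yet, with their ranks -/
  pending : ℕ → Option ℕ
  /-- nodes known to have joined the MIS during the greedy stage -/
  joined : Set ℕ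
  /-- neighbours in the remnant graph that still take part in Luby's algorithm -/
  active : Set ℕ
  halted : Prop

/-- The length of a stage. -/
def stageLength (n : ℕ) : ℕ := (Nat.sqrt n + 1) * (Nat.log 2 n + 1)

/-- The node is in the random sample. -/
def Sampled (c : ℝ) (view : LocalView) (tape : Tape) : Prop :=
  (tape 0 : ℝ) < c / Real.sqrt view.n

/-- A random number, uniform in `{0, …, n ^ 4 - 1}` almost surely. -/
def randomRank (view : LocalView) (x : unitInterval) : ℕ := ⌊(x : ℝ) * (view.n : ℝ) ^ 4⌋₊

/-- The rank of a sampled node in the randomized greedy algorithm. -/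
def greedyRank (view : LocalView) (tape : Tape) : ℕ := randomRank view (tape 1)

/-- The random number of a node in phase `j` of Luby's algorithm. -/
def lubyRank (view : LocalView) (tape : Tape) (j : ℕ) : ℕ := randomRank view (tape (j + 2))

/-- Own rank `r` beats all the ranks `others i`; ties are broken by ID. -/
def LocalMax (view : LocalView) (r : ℕ) (others : ℕ → Option ℕ) : Prop :=
  ∀ i r', others i = some r' → r' < r ∨ (r' = r ∧ i < view.self)

/-- In the depth-2 BFS tree of the neighbour `k`, the neighbour `i` is a child of the node itself:
`i` is at distance two from `k`, and the node itself has the lowest ID among the common neighbours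
of `k` and `i`. -/
def IsTreeChild (view : LocalView) (k i : ℕ) : Prop :=
  view.adj view.self k ∧ view.adj view.self i ∧ i ≠ k ∧ ¬ view.adj k i ∧
    ∀ x < view.self, ¬ (view.adj k x ∧ view.adj x i)

open Classical in
/-- The joined neighbours in whose BFS trees `i` is a child of the node itself. -/
def relayList (view : LocalView) (joined : Set ℕ) (i : ℕ) : List ℕ :=
  (List.range view.size).filter fun k => k ∈ joined ∧ IsTreeChild view k i

/-- Every node starts undecided. -/
def init (_ : LocalView) (_ : Tape) : MISState where
  decided := none
  announce := False
  pending _ := none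
  joined := ∅
  active := ∅
  halted := False

open Classical in
/-- Greedy stage: in round `0` the sampled nodes send their ranks to all neighbours; later, they
announce to all neighbours that they joined (`1`) or dropped out (`0`). -/
def sendGreedy (c : ℝ) (view : LocalView) (tape : Tape) (t : ℕ) (s : MISState) :
    Option (ℕ × List IDVar) :=
  if t = 0 then
    if Sampled c view tape then some (greedyRank view tape, []) else none
  else if s.announce then some (if s.decided = some true then 1 else 0, [])
  else none

open Classical in
/-- Luby's algorithm: in round `0` of a phase the remaining nodes send their random numbers; in
round `1` the winners announce that they join; in round `2` their neighbours announce that they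
leave. Only neighbours in the current remnant graph are addressed. -/
def sendLuby (view : LocalView) (tape : Tape) (l : ℕ) (s : MISState) (i : ℕ) :
    Option (ℕ × List IDVar) :=
  if i ∈ s.active then
    if l % 3 = 0 then some (lubyRank view tape (l / 3), [])
    else if l % 3 = 1 then (if s.decided = some true then some (1, []) else none)
    else (if s.decided = some false then some (0, []) else none)
  else none

/-- The message to the neighbour `i` in round `t`. -/
def send (c : ℝ) (view : LocalView) (tape : Tape) (t : ℕ) (s : MISState) (i : ℕ) :
    Option (ℕ × List IDVar) :=
  let L := stageLength view.n
  if t ≤ L then sendGreedy c view tape t s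
  else if t ≤ 2 * L then
    (relayList view s.joined i)[t - (L + 1)]?.map fun k => (0, [IDVar.known k])
  else sendLuby view tape (t - (2 * L + 1)) s i

open Classical in
/-- Greedy stage: a node with a neighbour that joined drops out; a sampled node joins as soon as it
is a local maximum among the undecided sampled nodes (not in the last round, after which it could
no longer announce this). -/
def receiveGreedy (c : ℝ) (view : LocalView) (tape : Tape) (t : ℕ)
    (inbox : ℕ → Option (ℕ × ℕ)) (s : MISState) : MISState :=
  let newJoined : Set ℕ := {i | t ≠ 0 ∧ ∃ l, inbox i = some (1, l)}
  let pending : ℕ → Option ℕ :=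
    if t = 0 then fun i => (inbox i).map Prod.fst
    else fun i => if (inbox i).isSome then none else s.pending i
  let drops : Prop := s.decided = none ∧ newJoined.Nonempty
  let joins : Prop := s.decided = none ∧ ¬ newJoined.Nonempty ∧ Sampled c view tape ∧
    t < stageLength view.n ∧ LocalMax view (greedyRank view tape) pending
  { s with
    decided := if joins then some true else if drops then some false else s.decided
    announce := joins ∨ (drops ∧ Sampled c view tape)
    pending := pending
    joined := s.joined ∪ newJoined }

open Classical in
/-- Informing stage: a node identifies the received IDs among those it knows. At the end of the
stage, decided nodes halt, and the other ones compute their neighbours in the remnant graph: those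
that are not adjacent to a node that joined. -/
def receiveInform (view : LocalView) (t : ℕ) (cmp : IDVar → IDVar → Option Ordering)
    (s : MISState) : MISState :=
  let joined : Set ℕ :=
    s.joined ∪ {k | ∃ i, cmp (.received t i 0) (.known k) = some .eq}
  if t = 2 * stageLength view.n then
    { s with
      joined := joined
      active := {i | view.adj view.self i ∧ ∀ k ∈ joined, ¬ view.adj i k}
      halted := s.decided ≠ none }
  else { s with joined := joined }

open Classical in
/-- Luby's algorithm: a local maximum joins, informs its neighbours and halts; its neighbours inform
their neighbours and halt. -/
def receiveLuby (view : LocalView) (tape : Tape) (l : ℕ) (inbox : ℕ → Option (ℕ × ℕ))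
    (s : MISState) : MISState :=
  if l % 3 = 0 then
    { s with
      decided := if LocalMax view (lubyRank view tape (l / 3)) (fun i => (inbox i).map Prod.fst)
        then some true else s.decided }
  else if l % 3 = 1 then
    if s.decided = some true then { s with halted := True }
    else { s with decided := if ∃ i, (inbox i).isSome then some false else s.decided }
  else
    if s.decided = some false then { s with halted := True }
    else { s with active := {i | i ∈ s.active ∧ inbox i = none} }

/-- The update of the state in round `t`. -/
def receive (c : ℝ) (view : LocalView) (tape : Tape) (t : ℕ)
    (cmp : IDVar → IDVar → Option Ordering) (inbox : ℕ → Option (ℕ × ℕ)) (s : MISState) :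
    MISState :=
  let L := stageLength view.n
  if t ≤ L then receiveGreedy c view tape t inbox s
  else if t ≤ 2 * L then receiveInform view t cmp s
  else receiveLuby view tape (t - (2 * L + 1)) inbox s

/-- The MIS algorithm with sampling probability `c / √n`. -/
def algorithm (c : ℝ) : CompAlgorithm where
  State := MISState
  init := init
  send := send c
  receive := receive c
  halted s := s.halted
  output s := s.decided = some true

/-- The nodes of the remnant graph: those undecided at the beginning of Luby's algorithm. -/
def remnant (c : ℝ) {V : Type*} [Fintype V] {N : ℕ} (W : Network V N)
    (ω : V × ℕ → unitInterval) : Set V :=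
  {v | ((algorithm c).config W 2 ω (2 * stageLength (Fintype.card V) + 1) v).state.decided = none}

end KT2MIS

end

/-! Correctness is deterministic. The greedy stage is matched with an abstract process `greedyProc`,
cut off after `L` rounds. Even if the cut-off comes too early, the joined nodes are independent,
every dropped node has a joined neighbour, and the undecided nodes are exactly those with no joined
node in their closed neighbourhood. A remnant node is therefore never disregarded by a neighbour,
whatever the informing stage has delivered, so Luby's algorithm runs faithfully on the remnant
graph. Each of its phases removes at least the node with the largest key, so it terminates within
`n` phases. The invariants `GreedyInv`, `InformInv` and `LubyInv` tie the execution to these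
abstract processes.

The bounds require three events, each failing with probability at most `n ^ (-(a + 2))`.

At most `L` nodes are sampled: a union bound over the `L`-subsets. Then the parallel process
completes and computes the sequential greedy MIS (`greedyProc_eq_greedyMIS`), and every relay list
is delivered within the informing stage.

The remnant has small degrees (`tapeMeasure_real_leftover_le`). Fix `v`, and for a set `D` of nodes
let `F D` be the event that greedy on `S \ D` leaves `v` undominated with `D` as its exact set of
undominated neighbours. The events `F D` are pairwise disjoint (`undominated_neighbors_unique`), and
`F D` does not depend on the sampling of `D`. If `D` is the set of leftover neighbours of `v`, then
`F D` holds and no node of `D` is sampled. By independence the degree is at least `d` with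
probability at most the sum over `|D| ≥ d` of `P(F D) * exp (-q d)`, hence at most `exp (-q d)`,
where `q = c / √n`.

Luby's algorithm is fast: in expectation a phase leaves at most `15/16` of the edges
(`sum_tapeMeasure_real_mem_darts_lubyStep_le`), so `O(log n)` phases suffice.

The first stage costs two broadcasts per sampled node, and the second at most one message for each
pair of a joined node and a receiver. Together this is at most `3 L n` messages. Each round of
Luby's algorithm costs at most `n` times the remnant degree bound. -/

set_option linter.unusedSectionVars false

/-! ### Positions of IDs -/

namespace Network

variable {V : Type*} [Fintype V] {N : ℕ} (W : Network V N) {ρ : ℕ} {v u w : V}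

theorem mem_knownIDs {x : Fin N} :
    x ∈ W.knownIDs ρ v ↔ ∃ w, W.graph.edist v w ≤ (ρ : ℕ∞) ∧ W.id w = x := by
  simp [knownIDs]

theorem id_mem_knownIDs (h : W.graph.edist v w ≤ (ρ : ℕ∞)) : W.id w ∈ W.knownIDs ρ v :=
  W.mem_knownIDs.2 ⟨w, h, rfl⟩

theorem nodup_knownIDs : (W.knownIDs ρ v).Nodup := Finset.sort_nodup _ _

theorem knownIDs_getElem?_index (h : W.graph.edist v w ≤ (ρ : ℕ∞)) :
    (W.knownIDs ρ v)[W.index ρ v w]? = some (W.id w) :=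
  List.getElem?_idxOf (W.id_mem_knownIDs h)

theorem exists_of_knownIDs_getElem? {i : ℕ} {x : Fin N} (h : (W.knownIDs ρ v)[i]? = some x) :
    ∃ w, W.graph.edist v w ≤ (ρ : ℕ∞) ∧ W.id w = x ∧ W.index ρ v w = i := by
  obtain ⟨w, hw, rfl⟩ := W.mem_knownIDs.1 (List.mem_of_getElem? h)
  refine ⟨w, hw, rfl, ?_⟩
  obtain ⟨hi, h⟩ := List.getElem?_eq_some_iff.1 h
  rw [index, ← h]
  exact W.nodup_knownIDs.idxOf_getElem i hi

theorem index_eq_of_getElem? {i : ℕ} (h : (W.knownIDs ρ v)[i]? = some (W.id w)) :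
    W.graph.edist v w ≤ (ρ : ℕ∞) ∧ W.index ρ v w = i := by
  obtain ⟨x, hx, hid, hi⟩ := W.exists_of_knownIDs_getElem? h
  obtain rfl := W.id.injective hid
  exact ⟨hx, hi⟩

theorem index_injOn (hu : W.graph.edist v u ≤ (ρ : ℕ∞)) (hw : W.graph.edist v w ≤ (ρ : ℕ∞))
    (h : W.index ρ v u = W.index ρ v w) : u = w := by
  have h1 := W.knownIDs_getElem?_index hu
  rw [h, W.knownIDs_getElem?_index hw] at h1
  exact (W.id.injective (Option.some_injective _ h1)).symm

theorem index_lt_length (hu : W.graph.edist v u ≤ (ρ : ℕ∞)) :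
    W.index ρ v u < (W.knownIDs ρ v).length :=
  List.idxOf_lt_length_iff.2 (W.id_mem_knownIDs hu)

theorem index_lt_index_iff (hu : W.graph.edist v u ≤ (ρ : ℕ∞))
    (hw : W.graph.edist v w ≤ (ρ : ℕ∞)) :
    W.index ρ v u < W.index ρ v w ↔ W.id u < W.id w := by
  have hs : (W.knownIDs ρ v).SortedLT := Finset.sortedLT_sort _
  have h1 := W.index_lt_length hu
  have h2 := W.index_lt_length hw
  have e1 : (W.knownIDs ρ v).get ⟨_, h1⟩ = W.id u := List.getElem_idxOf h1
  have e2 : (W.knownIDs ρ v).get ⟨_, h2⟩ = W.id w := List.getElem_idxOf h2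
  rw [← e1, ← e2, hs.strictMono_get.lt_iff_lt, Fin.mk_lt_mk]

theorem nodeAt_eq_some_iff {i : ℕ} :
    W.nodeAt ρ v i = some u ↔ (W.knownIDs ρ v)[i]? = some (W.id u) := by
  unfold nodeAt
  constructor
  · intro h
    split_ifs at h with hx
    rw [← Option.some_injective _ h]
    exact hx.choose_spec
  · intro h
    have hx : ∃ w, (W.knownIDs ρ v)[i]? = some (W.id w) := ⟨u, h⟩
    rw [dif_pos hx]
    have := h.symm.trans hx.choose_spec
    exact congrArg some (W.id.injective (Option.some_injective _ this)).symm

theorem nodeAt_index (hu : W.graph.edist v u ≤ (ρ : ℕ∞)) :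
    W.nodeAt ρ v (W.index ρ v u) = some u :=
  W.nodeAt_eq_some_iff.2 (W.knownIDs_getElem?_index hu)

/-! Distances at most two. -/

theorem edist_self_le : W.graph.edist v v ≤ ((2 : ℕ) : ℕ∞) := by simp

theorem edist_le_one_of_adj (h : W.graph.Adj v u) : W.graph.edist v u ≤ ((1 : ℕ) : ℕ∞) := by
  simp [SimpleGraph.edist_eq_one_iff_adj.2 h]

theorem edist_le_two_of_adj (h : W.graph.Adj v u) : W.graph.edist v u ≤ ((2 : ℕ) : ℕ∞) :=
  (W.edist_le_one_of_adj h).trans (by norm_num)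

theorem edist_le_two_of_adj_adj (h : W.graph.Adj v u) (h' : W.graph.Adj u w) :
    W.graph.edist v w ≤ ((2 : ℕ) : ℕ∞) := by
  refine (SimpleGraph.edist_triangle (v := u)).trans ?_
  rw [SimpleGraph.edist_eq_one_iff_adj.2 h, SimpleGraph.edist_eq_one_iff_adj.2 h']
  norm_num

theorem exists_common_neighbor (h : W.graph.edist v w ≤ ((2 : ℕ) : ℕ∞)) (hne : v ≠ w)
    (hadj : ¬ W.graph.Adj v w) : ∃ u, W.graph.Adj v u ∧ W.graph.Adj u w := by
  obtain ⟨p, hp⟩ := SimpleGraph.exists_walk_of_edist_ne_top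
    (ne_top_of_le_ne_top (ENat.natCast_ne_top 2) h)
  have hl : p.length ≤ 2 := by exact_mod_cast hp ▸ h
  match p, hl with
  | .nil, _ => exact absurd rfl hne
  | .cons h1 .nil, _ => exact absurd h1 hadj
  | .cons h1 (.cons h2 .nil), _ => exact ⟨_, h1, h2⟩
  | .cons _ (.cons _ (.cons _ q)), hl => simp [SimpleGraph.Walk.length_cons] at hl

theorem localView_adj_index (hu : W.graph.edist v u ≤ ((2 : ℕ) : ℕ∞))
    (hw : W.graph.edist v w ≤ ((2 : ℕ) : ℕ∞))
    (h : W.graph.edist v u ≤ ((1 : ℕ) : ℕ∞) ∨ W.graph.edist v w ≤ ((1 : ℕ) : ℕ∞)) :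
    (W.localView 2 v).adj (W.index 2 v u) (W.index 2 v w) ↔ W.graph.Adj u w := by
  constructor
  · rintro ⟨a, b, ha, hb, hab, -⟩
    rw [W.knownIDs_getElem?_index hu] at ha
    rw [W.knownIDs_getElem?_index hw] at hb
    rwa [W.id.injective (Option.some_injective _ ha), W.id.injective (Option.some_injective _ hb)]
  · intro hab
    exact ⟨u, w, W.knownIDs_getElem?_index hu, W.knownIDs_getElem?_index hw, hab, h⟩

theorem exists_of_localView_adj {i j : ℕ} (h : (W.localView 2 v).adj i j) :
    ∃ a b, W.graph.edist v a ≤ ((2 : ℕ) : ℕ∞) ∧ W.graph.edist v b ≤ ((2 : ℕ) : ℕ∞) ∧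
      W.index 2 v a = i ∧ W.index 2 v b = j ∧ W.graph.Adj a b := by
  obtain ⟨a, b, ha, hb, hab, -⟩ := h
  obtain ⟨h1, h2⟩ := W.index_eq_of_getElem? ha
  obtain ⟨h3, h4⟩ := W.index_eq_of_getElem? hb
  exact ⟨a, b, h1, h3, h2, h4, hab⟩

theorem localView_self : (W.localView 2 v).self = W.index 2 v v := rfl

theorem localView_adj_self_index_iff {i : ℕ} :
    (W.localView 2 v).adj (W.localView 2 v).self i ↔ ∃ u, W.graph.Adj v u ∧ W.index 2 v u = i := by
  constructor
  · intro h
    obtain ⟨a, b, ha, hb, hai, rfl, hab⟩ := W.exists_of_localView_adj h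
    obtain rfl := W.index_injOn ha W.edist_self_le hai
    exact ⟨b, hab, rfl⟩
  · rintro ⟨u, hu, rfl⟩
    exact (W.localView_adj_index W.edist_self_le (W.edist_le_two_of_adj hu) (.inl (by simp))).2 hu

end Network

/-! ### Inboxes, initially known IDs and halted nodes in a general execution -/

namespace CompAlgorithm

variable {V : Type*} [Fintype V] {N : ℕ} (A : CompAlgorithm) (W : Network V N)
  (ω : V × ℕ → unitInterval) {v u : V}

theorem inbox_index (C : V → A.NodeConfig N) (t : ℕ)
    (h : W.graph.edist v u ≤ ((2 : ℕ) : ℕ∞)) :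
    A.inbox W 2 ω C t v (W.index 2 v u) = A.message W 2 ω C t u v := by
  rw [inbox, W.nodeAt_index h]
  rfl

theorem adj_of_message_eq_some {ρ : ℕ} {C : V → A.NodeConfig N} {t : ℕ} {m : Message N}
    (h : A.message W ρ ω C t v u = some m) :
    W.graph.Adj v u ∧ ¬ A.halted (C v).state := by
  unfold message at h
  split_ifs at h with h'
  exact h'

theorem inbox_eq_some_iff {C : V → A.NodeConfig N} {t : ℕ} {i : ℕ} {m : Message N} :
    A.inbox W 2 ω C t v i = some m ↔
      ∃ u, W.graph.Adj v u ∧ W.index 2 v u = i ∧ A.message W 2 ω C t u v = some m := by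
  constructor
  · intro h
    obtain ⟨u, hu, hm⟩ := Option.bind_eq_some_iff.1 h
    have := W.index_eq_of_getElem? (W.nodeAt_eq_some_iff.1 hu)
    exact ⟨u, (A.adj_of_message_eq_some W ω hm).1.symm, this.2, hm⟩
  · rintro ⟨u, hu, rfl, hm⟩
    rw [A.inbox_index W ω C t (W.edist_le_two_of_adj hu), hm]

theorem config_var_known (ρ : ℕ) (t : ℕ) (v : V) (i : ℕ) :
    (A.config W ρ ω t v).var (.known i) = (W.knownIDs ρ v)[i]? := by
  induction t with
  | zero => rfl
  | succ t ih =>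
    rw [config, nextConfig]
    split_ifs
    · exact ih
    · exact ih

theorem config_succ_of_halted {ρ t : ℕ} (h : A.halted (A.config W ρ ω t v).state) :
    A.config W ρ ω (t + 1) v = A.config W ρ ω t v := by
  rw [config, nextConfig, if_pos h]

theorem config_of_halted {ρ t : ℕ} (h : A.halted (A.config W ρ ω t v).state) {s : ℕ}
    (hs : t ≤ s) : A.config W ρ ω s v = A.config W ρ ω t v := by
  induction s, hs using Nat.le_induction with
  | base => rfl
  | succ s _ ih => rw [A.config_succ_of_halted W ω (by rwa [ih]), ih]

theorem HaltedBy.outputSet_eq {ρ t s : ℕ} (h : A.HaltedBy W ρ ω t) (hs : t ≤ s) :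
    A.outputSet W ρ ω s = A.outputSet W ρ ω t := by
  ext v
  simp only [outputSet, Set.mem_ofPred_eq, A.config_of_halted W ω (h v) hs]

end CompAlgorithm

/-! ### Greedy maximal independent sets -/

section Greedy

variable {V : Type*} [Finite V] {α : Type*} [LinearOrder α]

theorem wellFounded_higher (key : V → α) : WellFounded fun w v : V => key v < key w :=
  haveI : IsTrans V fun w v : V => key v < key w := ⟨fun _ _ _ h h' => h'.trans h⟩
  haveI : Std.Irrefl fun w v : V => key v < key w := ⟨fun _ => lt_irrefl _⟩
  Finite.wellFounded_of_trans_of_irrefl _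

/-- The set computed by the sequential greedy algorithm that processes the nodes of `S` by
decreasing key. -/
def greedyMIS (G : SimpleGraph V) (key : V → α) (S : Set V) : Set V :=
  {v | (wellFounded_higher key).fix (C := fun _ => Prop)
    (fun v ih => v ∈ S ∧ ∀ w, G.Adj v w → ∀ h : key v < key w, ¬ ih w h) v}

variable {G : SimpleGraph V} {key : V → α} {S : Set V}

theorem mem_greedyMIS_iff {v : V} : v ∈ greedyMIS G key S ↔
    v ∈ S ∧ ∀ w, G.Adj v w → key v < key w → w ∉ greedyMIS G key S := by
  unfold greedyMIS
  rw [Set.mem_ofPred_eq, WellFounded.fix_eq]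
  rfl

theorem greedyMIS_subset : greedyMIS G key S ⊆ S := fun _ h => (mem_greedyMIS_iff.1 h).1

theorem not_adj_of_mem_greedyMIS (hk : Function.Injective key) {v w : V}
    (hv : v ∈ greedyMIS G key S) (hw : w ∈ greedyMIS G key S) : ¬ G.Adj v w := by
  intro h
  rcases lt_trichotomy (key v) (key w) with hlt | heq | hlt
  · exact (mem_greedyMIS_iff.1 hv).2 w h hlt hw
  · exact h.ne (hk heq)
  · exact (mem_greedyMIS_iff.1 hw).2 v h.symm hlt hv

/-- The nodes that have no neighbour in `O` and are not in `O` either. -/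
def undominated (G : SimpleGraph V) (O : Set V) : Set V :=
  {v | v ∉ O ∧ ∀ w, G.Adj v w → w ∉ O}

/-- An undominated node of `S` would have been chosen when its turn came. Hence all leftover nodes
are unsampled, which is the source of the exponential decay in the degree bound. -/
theorem disjoint_undominated_greedyMIS {v : V} (hv : v ∈ undominated G (greedyMIS G key S)) :
    v ∉ S := fun h => hv.1 (mem_greedyMIS_iff.2 ⟨h, fun w hw _ => hv.2 w hw⟩)

/-- The greedy decision on a node depends only on the members of `S` whose key is not below its own.
-/
theorem greedyMIS_congr_of_higher {S₁ S₂ : Set V} {v : V}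
    (h : ∀ w, key v < key w → (w ∈ S₁ ↔ w ∈ S₂)) (w : V) (hw : key v < key w) :
    w ∈ greedyMIS G key S₁ ↔ w ∈ greedyMIS G key S₂ := by
  induction w using (wellFounded_higher key).induction with
  | _ w ih =>
    rw [mem_greedyMIS_iff, mem_greedyMIS_iff, h w hw]
    refine and_congr_right fun _ => forall_congr' fun x => ?_
    refine imp_congr_right fun _ => forall_congr' fun hx => ?_
    exact not_congr (ih x hx (hw.trans hx))

/-- If `v` stays undominated with undominated neighbours `D₁` when the nodes of `D₁` are removed
from `S`, and the same holds for `D₂`, then `D₁ = D₂`. -/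
theorem undominated_neighbors_unique {v : V} {D₁ D₂ : Set V}
    (hv₁ : v ∈ undominated G (greedyMIS G key (S \ D₁)))
    (hv₂ : v ∈ undominated G (greedyMIS G key (S \ D₂)))
    (h₁ : {w | G.Adj v w ∧ w ∈ undominated G (greedyMIS G key (S \ D₁))} = D₁)
    (h₂ : {w | G.Adj v w ∧ w ∈ undominated G (greedyMIS G key (S \ D₂))} = D₂) : D₁ = D₂ := by
  -- Suppose that the two sets agree above `u`, but `u` lies only in `S \ E₁`. Then `u` is in `E₂`,
  -- so it is a neighbour of `v` that greedy on `S \ E₂` leaves undominated. The decisions above `u`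
  -- agree, so greedy on `S \ E₁` would choose `u` and dominate `v`.
  have main : ∀ {E₁ E₂ : Set V}, v ∈ undominated G (greedyMIS G key (S \ E₁)) →
      {w | G.Adj v w ∧ w ∈ undominated G (greedyMIS G key (S \ E₂))} = E₂ →
      ∀ u, (∀ w, key u < key w → (w ∈ S \ E₁ ↔ w ∈ S \ E₂)) → u ∈ S \ E₁ → u ∈ S \ E₂ := by
    intro E₁ E₂ hv hE u hu hu1
    refine ⟨hu1.1, fun hu2 => ?_⟩
    rw [← hE] at hu2
    refine hv.2 u hu2.1 (mem_greedyMIS_iff.2 ⟨hu1, fun w hw hlt => ?_⟩)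
    rw [greedyMIS_congr_of_higher hu w hlt]
    exact hu2.2.2 w hw
  have hS : ∀ u, u ∈ S \ D₁ ↔ u ∈ S \ D₂ := fun u => by
    induction u using (wellFounded_higher key).induction with
    | _ u ih =>
      exact ⟨main hv₁ h₂ u ih, main hv₂ h₁ u fun w hw => (ih w hw).symm⟩
  -- Each `D` is recovered from `S \ D` alone, as the set of undominated neighbours of `v`.
  rw [← h₁, ← h₂, Set.ext hS]

open Classical in
/-- Parallel greedy on `S` for `L` rounds: the decisions of the nodes before round `t`. -/
noncomputable def greedyProc (G : SimpleGraph V) (key : V → α) (S : Set V) (L : ℕ) :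
    ℕ → V → Option Bool
  | 0, _ => none
  | t + 1, v =>
    if greedyProc G key S L t v ≠ none then greedyProc G key S L t v
    else if ∃ u, G.Adj v u ∧ greedyProc G key S L t u = some true then some false
    else if v ∈ S ∧ t < L ∧
        ∀ u, G.Adj v u → u ∈ S → greedyProc G key S L t u = none → key u < key v then some true
    else none

variable {L t : ℕ} {v : V}

theorem greedyProc_succ_of_eq_some {b : Bool} (h : greedyProc G key S L t v = some b) :
    greedyProc G key S L (t + 1) v = some b := by
  rw [greedyProc, if_pos (by simp [h]), h]

theorem greedyProc_of_eq_some {b : Bool} (h : greedyProc G key S L t v = some b) {s : ℕ}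
    (hs : t ≤ s) : greedyProc G key S L s v = some b := by
  induction s, hs using Nat.le_induction with
  | base => exact h
  | succ s _ ih => exact greedyProc_succ_of_eq_some ih

theorem greedyProc_eq_none_of_le {s : ℕ} (hs : t ≤ s) (h : greedyProc G key S L s v = none) :
    greedyProc G key S L t v = none := by
  rcases h' : greedyProc G key S L t v with _ | b
  · rfl
  · rw [greedyProc_of_eq_some h' hs] at h
    cases h

theorem greedyProc_succ_ne_none_of_adj {u : V} (h : G.Adj v u)
    (hu : greedyProc G key S L t u = some true) : greedyProc G key S L (t + 1) v ≠ none := by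
  rw [greedyProc]
  split_ifs with h1 h2
  · exact h1
  · simp
  all_goals exact absurd ⟨u, h, hu⟩ h2

theorem exists_of_greedyProc_eq_some_false (h : greedyProc G key S L t v = some false) :
    ∃ u, G.Adj v u ∧ greedyProc G key S L t u = some true := by
  induction t with
  | zero => cases h
  | succ t ih =>
    have key' : ∃ u, G.Adj v u ∧ greedyProc G key S L t u = some true := by
      rw [greedyProc] at h
      split_ifs at h with h1 h2
      · exact ih h
      · exact h2
      · cases h
    obtain ⟨u, hu, hut⟩ := key'
    exact ⟨u, hu, greedyProc_succ_of_eq_some hut⟩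

/-- No bound on `L` is needed: a premature cut-off loses joins but never creates wrong ones. When
`v` joins, each sampled neighbour with a higher key has dropped out because of a joined neighbour,
which is in the greedy MIS by induction. -/
theorem mem_greedyMIS_of_greedyProc (hk : Function.Injective key)
    (h : greedyProc G key S L t v = some true) : v ∈ greedyMIS G key S := by
  induction t generalizing v with
  | zero => cases h
  | succ t ih =>
    rw [greedyProc] at h
    split_ifs at h with h1 h2 h3
    · exact ih h
    · simp at h
    · obtain ⟨hS, -, h3⟩ := h3
      refine mem_greedyMIS_iff.2 ⟨hS, fun w hw hlt hwM => ?_⟩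
      rcases hd : greedyProc G key S L t w with _ | _ | _
      · exact (h3 w hw (greedyMIS_subset hwM) hd).not_gt hlt
      · obtain ⟨x, hx, hxt⟩ := exists_of_greedyProc_eq_some_false hd
        exact not_adj_of_mem_greedyMIS hk hwM (ih hxt) hx
      · exact h2 ⟨w, hw, hd⟩

/-- Forbidding joins in the last round ensures that every join has been noticed by all neighbours
when the process stops. -/
theorem greedyProc_succ_eq_some_true_iff_last :
    greedyProc G key S L (L + 1) v = some true ↔ greedyProc G key S L L v = some true := by
  refine ⟨fun h => ?_, greedyProc_succ_of_eq_some⟩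
  rw [greedyProc] at h
  split_ifs at h with h1 h2 h3
  · exact h
  · simp at h
  · exact absurd h3.2.1 (lt_irrefl _)

/-- This is valid even when the process was cut off before completion, so the correctness of the
algorithm does not rely on the size of the sample. -/
theorem greedyProc_last_eq_none_iff :
    greedyProc G key S L (L + 1) v = none ↔
      v ∈ undominated G {u | greedyProc G key S L (L + 1) u = some true} := by
  constructor
  · intro h
    refine ⟨by simp [h], fun w hw hwt => ?_⟩
    exact greedyProc_succ_ne_none_of_adj hw (greedyProc_succ_eq_some_true_iff_last.1 hwt) h
  · rintro ⟨h1, h2⟩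
    rcases hd : greedyProc G key S L (L + 1) v with _ | _ | _
    · rfl
    · obtain ⟨x, hx, hxt⟩ := exists_of_greedyProc_eq_some_false hd
      exact absurd hxt (h2 x hx)
    · exact absurd hd h1

/-- In every round the undecided node of `S` with the largest key becomes decided: it joins unless a
neighbour has joined. So at least one sampled node is settled per round. -/
theorem ncard_undecided_add_le (ht : t ≤ L) (hk : Function.Injective key)
    (hne : ({v | v ∈ S ∧ greedyProc G key S L t v = none}).Nonempty) :
    ({v | v ∈ S ∧ greedyProc G key S L t v = none}).ncard + t ≤ S.ncard := by
  induction t with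
  | zero => simp [greedyProc]
  | succ t ih =>
    have hsub : {v | v ∈ S ∧ greedyProc G key S L (t + 1) v = none} ⊆
        {v | v ∈ S ∧ greedyProc G key S L t v = none} :=
      fun v hv => ⟨hv.1, greedyProc_eq_none_of_le t.le_succ hv.2⟩
    have hne' := hne.mono hsub
    obtain ⟨m, hm, hmax⟩ := Set.exists_max_image
      {v | v ∈ S ∧ greedyProc G key S L t v = none} key (Set.toFinite _) hne'
    have hm' : m ∉ {v | v ∈ S ∧ greedyProc G key S L (t + 1) v = none} := by
      rintro ⟨-, h⟩
      rw [greedyProc] at h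
      split_ifs at h with h1 h2 h3
      · exact h1 h
      · refine h3 ⟨hm.1, ht, fun u hu huS hun => ?_⟩
        exact lt_of_le_of_ne (hmax u ⟨huS, hun⟩) fun he => hu.ne (hk he).symm
    have hlt := Set.ncard_lt_ncard (hsub.ssubset_of_mem_notMem hm hm') (Set.toFinite _)
    have := ih (by omega) hne'
    omega

theorem greedyProc_ne_none_of_mem (hk : Function.Injective key) (hS : S.ncard ≤ L) (hv : v ∈ S) :
    greedyProc G key S L L v ≠ none := by
  intro h
  have hne : ({v | v ∈ S ∧ greedyProc G key S L L v = none}).Nonempty := ⟨v, hv, h⟩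
  have := ncard_undecided_add_le le_rfl hk hne
  have := (Set.ncard_pos (Set.toFinite _)).2 hne
  omega

theorem greedyProc_eq_greedyMIS (hk : Function.Injective key) (hS : S.ncard ≤ L) :
    {v | greedyProc G key S L (L + 1) v = some true} = greedyMIS G key S := by
  ext v
  refine ⟨mem_greedyMIS_of_greedyProc hk, fun hv => ?_⟩
  rcases hd : greedyProc G key S L (L + 1) v with _ | _ | _
  · exact absurd (greedyProc_eq_none_of_le L.le_succ hd)
      (greedyProc_ne_none_of_mem hk hS (greedyMIS_subset hv))
  · obtain ⟨x, hx, hxt⟩ := exists_of_greedyProc_eq_some_false hd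
    exact absurd hx (not_adj_of_mem_greedyMIS hk hv (mem_greedyMIS_of_greedyProc hk hxt))
  · exact hd

end Greedy

/-! ### The execution of the MIS algorithm -/

namespace KT2MIS

section Execution

variable {V : Type*} [Fintype V] {N : ℕ} (c : ℝ) (W : Network V N) (ω : V × ℕ → unitInterval)

/-- The length of a stage in the network on `V`. -/
noncomputable abbrev stage (V : Type*) [Fintype V] : ℕ := stageLength (Fintype.card V)

/-- The ordinary state of `v` before round `t`. -/
noncomputable def stateAt (t : ℕ) (v : V) : MISState := ((algorithm c).config W 2 ω t v).state

/-- The ordinary part of what `v` receives in round `t`. -/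
noncomputable def inboxAt (t : ℕ) (v : V) (i : ℕ) : Option (ℕ × ℕ) :=
  ((algorithm c).inbox W 2 ω ((algorithm c).config W 2 ω t) t v i).map
    fun m => (m.ord, m.ids.length)

/-- The results of the comparisons that are available to `v` in round `t`. -/
noncomputable def cmpAt (t : ℕ) (v : V) : IDVar → IDVar → Option Ordering :=
  CompAlgorithm.compareVars
    ((algorithm c).updateVars W 2 ω ((algorithm c).config W 2 ω t) t v)

/-- The sampled nodes. -/
def sampledSet : Set V := {v | (ω (v, 0) : ℝ) < c / Real.sqrt (Fintype.card V)}

/-- The random number of `v` computed from the entry `k` of its tape. -/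
noncomputable def rank (k : ℕ) (v : V) : ℕ := ⌊(ω (v, k) : ℝ) * (Fintype.card V : ℝ) ^ 4⌋₊

variable {c W ω} {t : ℕ} {v u : V}

theorem sampled_iff : Sampled c (W.localView 2 v) (CompAlgorithm.tapeOf ω v) ↔
    v ∈ sampledSet c ω := Iff.rfl

theorem greedyRank_eq : greedyRank (W.localView 2 v) (CompAlgorithm.tapeOf ω v) = rank ω 1 v := rfl

theorem lubyRank_eq (j : ℕ) :
    lubyRank (W.localView 2 v) (CompAlgorithm.tapeOf ω v) j = rank ω (j + 2) v := rfl

theorem stateAt_succ_of_halted (h : (stateAt c W ω t v).halted) :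
    stateAt c W ω (t + 1) v = stateAt c W ω t v :=
  congrArg CompAlgorithm.NodeConfig.state ((algorithm c).config_succ_of_halted W ω h)

theorem stateAt_succ (h : ¬ (stateAt c W ω t v).halted) :
    stateAt c W ω (t + 1) v = receive c (W.localView 2 v) (CompAlgorithm.tapeOf ω v) t
      (cmpAt c W ω t v) (inboxAt c W ω t v) (stateAt c W ω t v) := by
  have : (algorithm c).config W 2 ω (t + 1) v = _ := if_neg h
  exact congrArg CompAlgorithm.NodeConfig.state this

theorem sent_eq_some_iff {m : Message N} : (algorithm c).sent W 2 ω t v u = some m ↔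
    W.graph.Adj v u ∧ ¬ (stateAt c W ω t v).halted ∧ ∃ q, send c (W.localView 2 v)
      (CompAlgorithm.tapeOf ω v) t (stateAt c W ω t v) (W.index 2 v u) = some q ∧
      (⟨q.1, q.2.filterMap ((algorithm c).config W 2 ω t v).var⟩ : Message N) = m := by
  unfold CompAlgorithm.sent CompAlgorithm.message
  by_cases h : W.graph.Adj v u ∧ ¬ (algorithm c).halted ((algorithm c).config W 2 ω t v).state
  · rw [if_pos h]
    exact Option.map_eq_some_iff.trans ⟨fun h' => ⟨h.1, h.2, h'⟩, fun h' => h'.2.2⟩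
  · rw [if_neg h]
    exact ⟨fun h' => (by cases h'), fun h' => absurd ⟨h'.1, h'.2.1⟩ h⟩

theorem inboxAt_eq_some_iff {i : ℕ} {p : ℕ × ℕ} : inboxAt c W ω t v i = some p ↔
    ∃ u m, W.graph.Adj v u ∧ W.index 2 v u = i ∧ (algorithm c).sent W 2 ω t u v = some m ∧
      (m.ord, m.ids.length) = p := by
  unfold inboxAt
  rw [Option.map_eq_some_iff]
  constructor
  · rintro ⟨m, hm, rfl⟩
    obtain ⟨u, hu, hi, hm⟩ := ((algorithm c).inbox_eq_some_iff W ω).1 hm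
    exact ⟨u, m, hu, hi, hm, rfl⟩
  · rintro ⟨u, m, hu, hi, hm, rfl⟩
    exact ⟨m, ((algorithm c).inbox_eq_some_iff W ω).2 ⟨u, hu, hi, hm⟩, rfl⟩

theorem inboxAt_isSome_iff {i : ℕ} : (inboxAt c W ω t v i).isSome ↔
    ∃ u, W.graph.Adj v u ∧ W.index 2 v u = i ∧ ((algorithm c).sent W 2 ω t u v).isSome := by
  simp only [Option.isSome_iff_exists, inboxAt_eq_some_iff]
  constructor
  · rintro ⟨p, u, m, hu, hi, hm, rfl⟩
    exact ⟨u, hu, hi, m, hm⟩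
  · rintro ⟨u, hu, hi, m, hm⟩
    exact ⟨_, u, m, hu, hi, hm, rfl⟩

end Execution

end KT2MIS

/-- Ranks with ties broken by ID. -/
def Network.key {V : Type*} {N : ℕ} (W : Network V N) (r : V → ℕ) (v : V) : ℕ ×ₗ Fin N :=
  toLex (r v, W.id v)

theorem Network.key_injective {V : Type*} {N : ℕ} (W : Network V N) (r : V → ℕ) :
    Function.Injective (W.key r) := fun _ _ h =>
  W.id.injective (Prod.ext_iff.1 (toLex.injective h)).2

/-! ### The greedy stage of the execution -/

namespace KT2MIS

section Greedy

open scoped Classical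

variable {V : Type*} [Fintype V] {N : ℕ} {c : ℝ} {W : Network V N} {ω : V × ℕ → unitInterval}
  {t : ℕ} {v u : V}

/-- Ties are broken by positions in the sorted list of known IDs, and these are ordered like the IDs
themselves. -/
theorem localMax_iff {r : V → ℕ} {others : ℕ → Option ℕ} {P : V → Prop}
    (h : ∀ i r', others i = some r' ↔ ∃ u, W.graph.Adj v u ∧ W.index 2 v u = i ∧ P u ∧ r u = r') :
    LocalMax (W.localView 2 v) (r v) others ↔
      ∀ u, W.graph.Adj v u → P u → W.key r u < W.key r v := by
  have hlt : ∀ u, W.graph.Adj v u → (W.key r u < W.key r v ↔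
      r u < r v ∨ (r u = r v ∧ W.index 2 v u < (W.localView 2 v).self)) := fun u hu => by
    rw [W.localView_self, W.index_lt_index_iff (W.edist_le_two_of_adj hu) W.edist_self_le,
      Network.key, Network.key, Prod.Lex.toLex_lt_toLex]
  constructor
  · intro hm u hu hP
    exact (hlt u hu).2 (hm _ _ ((h _ _).2 ⟨u, hu, rfl, hP, rfl⟩))
  · intro hm i r' hi
    obtain ⟨u, hu, rfl, hP, rfl⟩ := (h _ _).1 hi
    exact (hlt u hu).1 (hm u hu hP)

variable (c W ω) in
/-- The decisions in the greedy stage. -/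
noncomputable def greedyDecision : ℕ → V → Option Bool :=
  greedyProc W.graph (W.key (rank ω 1)) (sampledSet c ω) (stage V)

theorem greedyDecision_succ : greedyDecision c W ω (t + 1) v =
    if greedyDecision c W ω t v ≠ none then greedyDecision c W ω t v
    else if ∃ u, W.graph.Adj v u ∧ greedyDecision c W ω t u = some true then some false
    else if v ∈ sampledSet c ω ∧ t < stage V ∧ ∀ u, W.graph.Adj v u →
        u ∈ sampledSet c ω ∧ greedyDecision c W ω t u = none →
        W.key (rank ω 1) u < W.key (rank ω 1) v then some true
    else none := by
  unfold greedyDecision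
  rw [greedyProc]
  simp only [and_imp]
  congr!

variable (c W ω) in
/-- The state before round `t` of the greedy stage. -/
structure GreedyInv (t : ℕ) (v : V) : Prop where
  not_halted : ¬ (stateAt c W ω t v).halted
  decided : (stateAt c W ω t v).decided = greedyDecision c W ω t v
  -- A decision reached in round `t - 1` is announced in round `t`, so neighbours lag one round
  -- behind. At `t = 0` the truncated `t - 1` is harmless, since nothing is decided at time `0`.
  announce : (stateAt c W ω t v).announce ↔ v ∈ sampledSet c ω ∧
    greedyDecision c W ω t v ≠ none ∧ greedyDecision c W ω (t - 1) v = none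
  pending : t ≠ 0 → ∀ i r', (stateAt c W ω t v).pending i = some r' ↔ ∃ u, W.graph.Adj v u ∧
    W.index 2 v u = i ∧ (u ∈ sampledSet c ω ∧ greedyDecision c W ω (t - 1) u = none) ∧
    rank ω 1 u = r'
  joined : (stateAt c W ω t v).joined = {i | ∃ u, W.graph.Adj v u ∧ W.index 2 v u = i ∧
    greedyDecision c W ω (t - 1) u = some true}

theorem sent_zero {m : Message N} : (algorithm c).sent W 2 ω 0 v u = some m ↔
    W.graph.Adj v u ∧ v ∈ sampledSet c ω ∧ (⟨rank ω 1 v, []⟩ : Message N) = m := by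
  rw [sent_eq_some_iff]
  have hh : ¬ (stateAt c W ω 0 v).halted := fun h => h
  simp only [send, sendGreedy, Nat.zero_le, if_true, sampled_iff, greedyRank_eq, hh]
  by_cases h : v ∈ sampledSet c ω
  · simp [h]
  · simp [h]

theorem sent_greedy (ht : t ≠ 0) (htL : t ≤ stage V) (hinv : GreedyInv c W ω t v) {m : Message N} :
    (algorithm c).sent W 2 ω t v u = some m ↔ W.graph.Adj v u ∧ v ∈ sampledSet c ω ∧
      greedyDecision c W ω t v ≠ none ∧ greedyDecision c W ω (t - 1) v = none ∧
      (⟨if greedyDecision c W ω t v = some true then 1 else 0, []⟩ : Message N) = m := by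
  rw [sent_eq_some_iff]
  have htL' : t ≤ stageLength (W.localView 2 v).n := htL
  simp only [send, sendGreedy, if_pos htL', if_neg ht, hinv.announce, hinv.not_halted,
    hinv.decided]
  by_cases h : v ∈ sampledSet c ω ∧
    greedyDecision c W ω t v ≠ none ∧ greedyDecision c W ω (t - 1) v = none
  · rw [if_pos h]
    simp [h]
  · rw [if_neg h]
    simp only [reduceCtorEq, false_and, exists_false, and_false, false_iff]
    tauto

theorem mem_sampledSet_of_greedyDecision (h : greedyDecision c W ω t v = some true) :
    v ∈ sampledSet c ω :=
  greedyMIS_subset (mem_greedyMIS_of_greedyProc (W.key_injective _) h)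

theorem greedyInv_zero (v : V) : GreedyInv c W ω 0 v where
  not_halted h := h
  decided := rfl
  announce := ⟨fun h => h.elim, fun h => h.2.1 rfl⟩
  pending h := absurd rfl h
  joined := by
    ext i
    refine ⟨fun h => h.elim, ?_⟩
    rintro ⟨u, -, -, h⟩
    cases h

/-- The effect of the announcements of round `t`. -/
theorem newJoined_iff (htL : t ≤ stage V) (hinv : ∀ v, GreedyInv c W ω t v) {i : ℕ} :
    (t ≠ 0 ∧ ∃ l, inboxAt c W ω t v i = some (1, l)) ↔ ∃ u, W.graph.Adj v u ∧ W.index 2 v u = i ∧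
      greedyDecision c W ω t u = some true ∧ greedyDecision c W ω (t - 1) u = none := by
  constructor
  · rintro ⟨ht, l, h⟩
    obtain ⟨u, m, hu, hi, hm, hp⟩ := inboxAt_eq_some_iff.1 h
    obtain ⟨-, -, hn, hn', rfl⟩ := (sent_greedy ht htL (hinv u)).1 hm
    refine ⟨u, hu, hi, ?_, hn'⟩
    by_contra hne
    simp [hne] at hp
  · rintro ⟨u, hu, hi, hd, hd'⟩
    have ht : t ≠ 0 := by
      rintro rfl
      cases hd
    refine ⟨ht, 0, inboxAt_eq_some_iff.2 ⟨u, ⟨1, []⟩, hu, hi, ?_, rfl⟩⟩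
    exact (sent_greedy ht htL (hinv u)).2
      ⟨hu.symm, mem_sampledSet_of_greedyDecision hd, by simp [hd], hd', by simp [hd]⟩

theorem pending_iff (htL : t ≤ stage V) (hinv : ∀ v, GreedyInv c W ω t v) (i r' : ℕ) :
    (if t = 0 then fun i => (inboxAt c W ω t v i).map Prod.fst
      else fun i => if (inboxAt c W ω t v i).isSome then none
        else (stateAt c W ω t v).pending i) i = some r' ↔
      ∃ u, W.graph.Adj v u ∧ W.index 2 v u = i ∧
        (u ∈ sampledSet c ω ∧ greedyDecision c W ω t u = none) ∧ rank ω 1 u = r' := by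
  by_cases ht : t = 0
  · subst ht
    rw [if_pos rfl, Option.map_eq_some_iff]
    constructor
    · rintro ⟨p, hp, rfl⟩
      obtain ⟨u, m, hu, hi, hm, rfl⟩ := inboxAt_eq_some_iff.1 hp
      obtain ⟨-, hS, rfl⟩ := sent_zero.1 hm
      exact ⟨u, hu, hi, ⟨hS, rfl⟩, rfl⟩
    · rintro ⟨u, hu, hi, ⟨hS, -⟩, rfl⟩
      exact ⟨_, inboxAt_eq_some_iff.2 ⟨u, _, hu, hi, sent_zero.2 ⟨hu.symm, hS, rfl⟩, rfl⟩, rfl⟩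
  · rw [if_neg ht]
    by_cases hs : (inboxAt c W ω t v i).isSome
    · simp only [hs, if_true, reduceCtorEq, false_iff]
      obtain ⟨u, hu, hi, hm⟩ := inboxAt_isSome_iff.1 hs
      obtain ⟨m, hm⟩ := Option.isSome_iff_exists.1 hm
      rintro ⟨u', hu', rfl, ⟨-, hn'⟩, -⟩
      obtain rfl := W.index_injOn (W.edist_le_two_of_adj hu) (W.edist_le_two_of_adj hu') hi
      exact ((sent_greedy ht htL (hinv _)).1 hm).2.2.1 hn'
    · simp only [hs]
      rw [if_neg (by simp), (hinv v).pending ht]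
      refine exists_congr fun u => and_congr_right fun hu => and_congr_right fun hi =>
        and_congr_left fun hr => and_congr_right fun hS => ?_
      constructor
      · intro hd
        by_contra hne
        exact hs (inboxAt_isSome_iff.2 ⟨u, hu, hi, Option.isSome_iff_exists.2
          ⟨_, (sent_greedy ht htL (hinv u)).2 ⟨hu.symm, hS, hne, hd, rfl⟩⟩⟩)
      · exact greedyProc_eq_none_of_le (Nat.sub_le t 1)

theorem greedyInv_succ (htL : t ≤ stage V) (hinv : ∀ v, GreedyInv c W ω t v) (v : V) :
    GreedyInv c W ω (t + 1) v := by
  have hst := stateAt_succ (hinv v).not_halted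
  have htL' : t ≤ stageLength (W.localView 2 v).n := htL
  rw [receive, if_pos htL', receiveGreedy] at hst
  have hD := (hinv v).decided
  have hjoin : ({i | t ≠ 0 ∧ ∃ l, inboxAt c W ω t v i = some (1, l)} : Set ℕ).Nonempty ↔
      ∃ u, W.graph.Adj v u ∧ greedyDecision c W ω t u = some true ∧
        greedyDecision c W ω (t - 1) u = none := by
    constructor
    · rintro ⟨i, hi⟩
      obtain ⟨u, hu, -, h⟩ := (newJoined_iff htL hinv).1 hi
      exact ⟨u, hu, h⟩
    · rintro ⟨u, hu, h⟩
      exact ⟨_, (newJoined_iff htL hinv).2 ⟨u, hu, rfl, h⟩⟩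
  -- For an undecided `v` every joined neighbour has joined just now: an earlier join would already
  -- have made `v` drop out.
  have hjoin' : greedyDecision c W ω t v = none →
      (({i | t ≠ 0 ∧ ∃ l, inboxAt c W ω t v i = some (1, l)} : Set ℕ).Nonempty ↔
        ∃ u, W.graph.Adj v u ∧ greedyDecision c W ω t u = some true) := by
    intro hn
    rw [hjoin]
    refine exists_congr fun u => and_congr_right fun hu => and_iff_left_of_imp fun h => ?_
    rcases t with _ | t
    · rfl
    rcases hd : greedyDecision c W ω t u with _ | _ | _
    · exact hd
    · exact absurd ((greedyProc_succ_of_eq_some hd).symm.trans h) (by simp)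
    · exact absurd hn (greedyProc_succ_ne_none_of_adj hu hd)
  have hmax := localMax_iff (W := W) (r := rank ω 1) (pending_iff (v := v) htL hinv)
  set others := (if t = 0 then fun i => (inboxAt c W ω t v i).map Prod.fst
      else fun i => if (inboxAt c W ω t v i).isSome then none
        else (stateAt c W ω t v).pending i) with hothers
  set newJ : Set ℕ := {i | t ≠ 0 ∧ ∃ l, inboxAt c W ω t v i = some (1, l)} with hnewJ
  have hdec : (stateAt c W ω (t + 1) v).decided = greedyDecision c W ω (t + 1) v := by
    rw [hst, greedyDecision_succ]
    simp only [sampled_iff, greedyRank_eq, hD, hmax]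
    by_cases h1 : greedyDecision c W ω t v = none
    · rw [hjoin' h1]
      simp only [h1, true_and]
      by_cases h2 : ∃ u, W.graph.Adj v u ∧ greedyDecision c W ω t u = some true
      · simp [h2]
      · simp only [h2, not_false_eq_true, true_and, if_false, ne_eq, not_true]
        rfl
    · simp [h1]
  refine ⟨?_, hdec, ?_, fun _ i r' => ?_, ?_⟩
  · rw [hst]
    exact (hinv v).not_halted
  · rw [hst]
    simp only [sampled_iff, greedyRank_eq, hD, hmax]
    rw [greedyDecision_succ, Nat.add_sub_cancel]
    by_cases h1 : greedyDecision c W ω t v = none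
    · rw [hjoin' h1]
      simp only [h1, true_and]
      by_cases h2 : ∃ u, W.graph.Adj v u ∧ greedyDecision c W ω t u = some true
      · simp [h2]
      · simp only [h2, not_false_eq_true, true_and, if_false, ne_eq, not_true, false_and, or_false,
          ite_eq_right_iff, reduceCtorEq, imp_false, not_not, and_true]
        exact ⟨fun h => ⟨h.1, h⟩, fun h => h.2⟩
    · simp [h1]
  · rw [hst]
    exact pending_iff htL hinv i r'
  · rw [hst]
    ext i
    simp only [(hinv v).joined, Set.mem_union, Set.mem_ofPred_eq, Nat.add_sub_cancel]
    rw [hnewJ, Set.mem_ofPred_eq, newJoined_iff htL hinv, ← exists_or]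
    refine exists_congr fun u => ?_
    rw [← and_or_left, ← and_or_left]
    refine and_congr_right fun _ => and_congr_right fun _ => ?_
    constructor
    · rintro (h | h)
      · exact greedyProc_of_eq_some h (Nat.sub_le t 1)
      · exact h.1
    · intro h
      rcases hd : greedyDecision c W ω (t - 1) u with _ | b
      · exact .inr ⟨h, rfl⟩
      · exact .inl ((greedyProc_of_eq_some hd (Nat.sub_le t 1)).symm.trans h)

theorem greedyInv (ht : t ≤ stage V + 1) (v : V) : GreedyInv c W ω t v := by
  induction t generalizing v with
  | zero => exact greedyInv_zero v
  | succ t ih => exact greedyInv_succ (by omega) (ih (by omega)) v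

end Greedy

end KT2MIS

/-! ### The informing stage of the execution -/

namespace KT2MIS

section Inform

open scoped Classical

variable {V : Type*} [Fintype V] {N : ℕ} {c : ℝ} {W : Network V N} {ω : V × ℕ → unitInterval}
  {t : ℕ} {v u w x : V}

variable (c W ω) in
/-- The nodes that join in the greedy stage. -/
def greedyJoined : Set V := {v | greedyDecision c W ω (stage V + 1) v = some true}

theorem not_adj_of_mem_greedyJoined (hv : v ∈ greedyJoined c W ω) (hu : u ∈ greedyJoined c W ω) :
    ¬ W.graph.Adj v u :=
  not_adj_of_mem_greedyMIS (W.key_injective _)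
    (mem_greedyMIS_of_greedyProc (W.key_injective _) hv)
    (mem_greedyMIS_of_greedyProc (W.key_injective _) hu)

theorem greedyDecision_eq_none_iff :
    greedyDecision c W ω (stage V + 1) v = none ↔
      v ∈ undominated W.graph (greedyJoined c W ω) :=
  greedyProc_last_eq_none_iff

theorem exists_mem_greedyJoined_of_eq_some_false
    (h : greedyDecision c W ω (stage V + 1) v = some false) :
    ∃ u, W.graph.Adj v u ∧ u ∈ greedyJoined c W ω :=
  exists_of_greedyProc_eq_some_false h

theorem greedyJoined_subset : greedyJoined c W ω ⊆ sampledSet c ω :=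
  fun _ => mem_sampledSet_of_greedyDecision

theorem stage_pos : 0 < stage V := Nat.mul_pos (Nat.succ_pos _) (Nat.succ_pos _)

variable (W) in
/-- In the depth-2 BFS tree of `x`, the node `w` is a child of `v`. -/
def TreeParent (x v w : V) : Prop :=
  W.graph.Adj v x ∧ W.graph.Adj v w ∧ w ≠ x ∧ ¬ W.graph.Adj x w ∧
    ∀ y, W.graph.Adj x y → W.graph.Adj y w → W.id v ≤ W.id y

/-- A node thus hears of each joined node at distance two from one sender only, which makes the
informing stage cheap. -/
theorem TreeParent.unique (h : TreeParent W x v w) (h' : TreeParent W x u w) : v = u :=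
  W.id.injective (le_antisymm (h.2.2.2.2 u h'.1.symm h'.2.1) (h'.2.2.2.2 v h.1.symm h.2.1))

theorem exists_treeParent (h : W.graph.edist w x ≤ ((2 : ℕ) : ℕ∞)) (hne : w ≠ x)
    (hadj : ¬ W.graph.Adj w x) : ∃ v, TreeParent W x v w := by
  obtain ⟨v, hv, hmin⟩ := Set.exists_min_image {v | W.graph.Adj w v ∧ W.graph.Adj v x} W.id
    (Set.toFinite _) (W.exists_common_neighbor h hne hadj)
  exact ⟨v, hv.2, hv.1.symm, hne, fun h => hadj h.symm, fun y hy hy' => hmin y ⟨hy'.symm, hy.symm⟩⟩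

/-- The KT-2 view suffices for this test. A competing parent `y` is a neighbour of `x`, hence within
distance two of `v`, and the edges from `y` to `x` and to `w` each have an end adjacent to `v`, so
both are visible to `v`. -/
theorem isTreeChild_iff (hw : W.graph.Adj v w) {k : ℕ} :
    IsTreeChild (W.localView 2 v) k (W.index 2 v w) ↔
      ∃ x, W.index 2 v x = k ∧ TreeParent W x v w := by
  unfold IsTreeChild
  rw [W.localView_adj_self_index_iff, W.localView_adj_self_index_iff]
  have hw2 := W.edist_le_two_of_adj hw
  have aux : ∀ x, W.graph.Adj v x → ((∀ j < (W.localView 2 v).self,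
      ¬ ((W.localView 2 v).adj (W.index 2 v x) j ∧
        (W.localView 2 v).adj j (W.index 2 v w))) ↔
      ∀ y, W.graph.Adj x y → W.graph.Adj y w → W.id v ≤ W.id y) := by
    intro x hx
    have hx2 := W.edist_le_two_of_adj hx
    constructor
    · intro h y hy hy'
      by_contra hlt
      have hy2 := W.edist_le_two_of_adj_adj hx hy
      refine h (W.index 2 v y) ((W.index_lt_index_iff hy2 W.edist_self_le).2 (not_le.1 hlt)) ⟨?_, ?_⟩
      · exact (W.localView_adj_index hx2 hy2 (.inl (W.edist_le_one_of_adj hx))).2 hy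
      · exact (W.localView_adj_index hy2 hw2 (.inr (W.edist_le_one_of_adj hw))).2 hy'
    · rintro h j hj ⟨h1, h2⟩
      obtain ⟨x', y, hx', hy2, hxx, rfl, -⟩ := W.exists_of_localView_adj h1
      rw [W.localView_adj_index hx2 hy2 (.inl (W.edist_le_one_of_adj hx))] at h1
      rw [W.localView_adj_index hy2 hw2 (.inr (W.edist_le_one_of_adj hw))] at h2
      exact (h y h1 h2).not_gt ((W.index_lt_index_iff hy2 W.edist_self_le).1 hj)
  constructor
  · rintro ⟨⟨x, hx, rfl⟩, -, hne, hadj, hmin⟩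
    have hx2 := W.edist_le_two_of_adj hx
    rw [W.localView_adj_index hx2 hw2 (.inl (W.edist_le_one_of_adj hx))] at hadj
    exact ⟨x, rfl, hx, hw, fun h => hne (by rw [h]), hadj, (aux x hx).1 hmin⟩
  · rintro ⟨x, rfl, hx, -, hne, hadj, hmin⟩
    have hx2 := W.edist_le_two_of_adj hx
    refine ⟨⟨x, hx, rfl⟩, ⟨w, hw, rfl⟩, fun h => hne (W.index_injOn hw2 hx2 h), ?_,
      (aux x hx).2 hmin⟩
    rwa [W.localView_adj_index hx2 hw2 (.inl (W.edist_le_one_of_adj hx))]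

variable (c W ω) in
/-- The positions of the IDs that `v` sends to `w` in the informing stage. -/
noncomputable def relays (v w : V) : List ℕ :=
  relayList (W.localView 2 v)
    {i | ∃ u, W.graph.Adj v u ∧ W.index 2 v u = i ∧ u ∈ greedyJoined c W ω} (W.index 2 v w)

theorem nodup_relays : (relays c W ω v w).Nodup := List.nodup_range.filter _

theorem mem_relays_iff (hw : W.graph.Adj v w) {k : ℕ} : k ∈ relays c W ω v w ↔
    ∃ x, W.index 2 v x = k ∧ x ∈ greedyJoined c W ω ∧ TreeParent W x v w := by
  simp only [relays, relayList, List.mem_filter, List.mem_range, decide_eq_true_eq,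
    isTreeChild_iff hw]
  constructor
  · rintro ⟨-, ⟨u, hu, huk, hJ⟩, x, hx, hT⟩
    obtain rfl := W.index_injOn (W.edist_le_two_of_adj hT.1) (W.edist_le_two_of_adj hu)
      (hx.trans huk.symm)
    exact ⟨x, hx, hJ, hT⟩
  · rintro ⟨x, rfl, hJ, hT⟩
    exact ⟨W.index_lt_length (W.edist_le_two_of_adj hT.1), ⟨x, hT.1, rfl, hJ⟩, x, rfl, hT⟩

variable (c W ω) in
/-- The state before round `t` of the informing stage. -/
structure InformInv (t : ℕ) (v : V) : Prop where
  not_halted : t ≤ 2 * stage V → ¬ (stateAt c W ω t v).halted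
  decided : (stateAt c W ω t v).decided = greedyDecision c W ω (stage V + 1) v
  exists_of_mem : ∀ i ∈ (stateAt c W ω t v).joined, ∃ x ∈ greedyJoined c W ω,
    W.graph.edist v x ≤ ((2 : ℕ) : ℕ∞) ∧ W.index 2 v x = i
  mem_of_adj : ∀ x ∈ greedyJoined c W ω, W.graph.Adj v x →
    W.index 2 v x ∈ (stateAt c W ω t v).joined
  -- Entry `p` of the list for an edge crosses it in round `stage V + 1 + p`; this is the
  -- completeness half of the invariant.
  mem_of_relays : ∀ s, stage V < s → s < t → ∀ u, W.graph.Adj v u → ∀ x ∈ greedyJoined c W ω,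
    TreeParent W x u v → (relays c W ω u v)[s - (stage V + 1)]? = some (W.index 2 u x) →
      W.index 2 v x ∈ (stateAt c W ω t v).joined

/-- The set `joined` grows during the stage, but the list for an edge stays fixed: only joined nodes
adjacent to the sender pass the filter, and those are all known when the stage begins. Indexing the
list by the round number is therefore consistent. -/
theorem relayList_eq_relays (hinv : InformInv c W ω t v) (hw : W.graph.Adj v w) :
    relayList (W.localView 2 v) (stateAt c W ω t v).joined (W.index 2 v w) =
      relays c W ω v w := by
  unfold relays relayList
  refine List.filter_congr fun k _ => ?_
  simp only [decide_eq_decide, isTreeChild_iff hw]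
  refine and_congr_left ?_
  rintro ⟨x, rfl, hT⟩
  constructor
  · intro h
    obtain ⟨y, hy, hy2, hxy⟩ := hinv.exists_of_mem _ h
    obtain rfl := W.index_injOn hy2 (W.edist_le_two_of_adj hT.1) hxy
    exact ⟨y, hT.1, rfl, hy⟩
  · rintro ⟨y, hy, hxy, hyJ⟩
    rw [← hxy]
    exact hinv.mem_of_adj y hyJ hy

theorem sent_inform (ht : stage V < t) (htL : t ≤ 2 * stage V) (hinv : InformInv c W ω t v)
    {m : Message N} : (algorithm c).sent W 2 ω t v w = some m ↔
      ∃ x ∈ greedyJoined c W ω, TreeParent W x v w ∧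
        (relays c W ω v w)[t - (stage V + 1)]? = some (W.index 2 v x) ∧
        (⟨0, [W.id x]⟩ : Message N) = m := by
  rw [sent_eq_some_iff]
  have h1 : ¬ t ≤ stageLength (W.localView 2 v).n := not_le.2 ht
  have h2 : t ≤ 2 * stageLength (W.localView 2 v).n := htL
  simp only [send, if_neg h1, if_pos h2]
  constructor
  · rintro ⟨hw, -, q, hq, rfl⟩
    rw [relayList_eq_relays hinv hw] at hq
    obtain ⟨k, hk, rfl⟩ := Option.map_eq_some_iff.1 hq
    obtain ⟨x, rfl, hJ, hT⟩ := (mem_relays_iff hw).1 (List.mem_of_getElem? hk)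
    refine ⟨x, hJ, hT, hk, ?_⟩
    have := (algorithm c).config_var_known W ω 2 t v (W.index 2 v x)
    rw [W.knownIDs_getElem?_index (W.edist_le_two_of_adj hT.1)] at this
    simp [this]
  · rintro ⟨x, hJ, hT, hk, rfl⟩
    refine ⟨hT.2.1, hinv.not_halted htL, (0, [IDVar.known (W.index 2 v x)]), ?_, ?_⟩
    · rw [relayList_eq_relays hinv hT.2.1]
      exact Option.map_eq_some_iff.2 ⟨_, hk, rfl⟩
    · have := (algorithm c).config_var_known W ω 2 t v (W.index 2 v x)
      rw [W.knownIDs_getElem?_index (W.edist_le_two_of_adj hT.1)] at this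
      simp [this]

theorem cmpAt_eq_some_eq_iff (ht : stage V < t) (htL : t ≤ 2 * stage V)
    (hinv : ∀ v, InformInv c W ω t v) {k : ℕ} :
    (∃ i, cmpAt c W ω t v (.received t i 0) (.known k) = some .eq) ↔
      ∃ x ∈ greedyJoined c W ω, ∃ u, TreeParent W x u v ∧
        (relays c W ω u v)[t - (stage V + 1)]? = some (W.index 2 u x) ∧ W.index 2 v x = k := by
  have hknown : (algorithm c).updateVars W 2 ω ((algorithm c).config W 2 ω t) t v (.known k) =
      (W.knownIDs 2 v)[k]? := (algorithm c).config_var_known W ω 2 t v k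
  have hrec : ∀ i, (algorithm c).updateVars W 2 ω ((algorithm c).config W 2 ω t) t v
      (.received t i 0) = ((algorithm c).inbox W 2 ω ((algorithm c).config W 2 ω t) t v i).bind
        fun m => m.ids[0]? := fun i => if_pos rfl
  simp only [cmpAt, CompAlgorithm.compareVars, hknown, hrec, Option.bind_eq_some_iff,
    Option.map_eq_some_iff, compare_eq_iff_eq]
  constructor
  · rintro ⟨i, y, ⟨m, hm, hy⟩, z, hz, rfl⟩
    obtain ⟨u, hu, hi, hm⟩ := ((algorithm c).inbox_eq_some_iff W ω).1 hm
    obtain ⟨x, hJ, hT, hk, rfl⟩ := (sent_inform ht htL (hinv u)).1 hm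
    refine ⟨x, hJ, u, hT, hk, ?_⟩
    obtain rfl : W.id x = y := by simpa using hy
    exact (W.index_eq_of_getElem? hz).2
  · rintro ⟨x, hJ, u, hT, hk, rfl⟩
    exact ⟨W.index 2 v u, W.id x, ⟨⟨0, [W.id x]⟩, ((algorithm c).inbox_eq_some_iff W ω).2
      ⟨u, hT.2.1.symm, rfl, (sent_inform ht htL (hinv u)).2 ⟨x, hJ, hT, hk, rfl⟩⟩, rfl⟩, W.id x,
      W.knownIDs_getElem?_index (W.edist_le_two_of_adj_adj hT.2.1.symm hT.1), rfl⟩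

theorem informInv_start (v : V) : InformInv c W ω (stage V + 1) v := by
  have h := greedyInv (c := c) (W := W) (ω := ω) (le_refl (stage V + 1)) v
  -- The greedy invariant describes the decisions of neighbours one round late; since nobody joins
  -- in the last round, nothing is missed.
  have hJ : ∀ u, greedyDecision c W ω (stage V + 1 - 1) u = some true ↔
      u ∈ greedyJoined c W ω := fun u => greedyProc_succ_eq_some_true_iff_last.symm
  refine ⟨fun _ => h.not_halted, h.decided, fun i hi => ?_, fun x hx hvx => ?_,
    fun s hs hs' => by omega⟩
  · rw [h.joined] at hi
    obtain ⟨u, hu, hi, hd⟩ := hi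
    exact ⟨u, (hJ u).1 hd, W.edist_le_two_of_adj hu, hi⟩
  · rw [h.joined]
    exact ⟨x, hvx, rfl, (hJ x).2 hx⟩

theorem stateAt_succ_inform (ht : stage V < t) (htL : t ≤ 2 * stage V)
    (hinv : InformInv c W ω t v) :
    stateAt c W ω (t + 1) v = receiveInform (W.localView 2 v) t (cmpAt c W ω t v)
      (stateAt c W ω t v) := by
  have h1 : ¬ t ≤ stageLength (W.localView 2 v).n := not_le.2 ht
  have h2 : t ≤ 2 * stageLength (W.localView 2 v).n := htL
  rw [stateAt_succ (hinv.not_halted htL), receive, if_neg h1, if_pos h2]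

theorem informInv_succ (ht : stage V < t) (htL : t ≤ 2 * stage V)
    (hinv : ∀ v, InformInv c W ω t v) (v : V) : InformInv c W ω (t + 1) v := by
  have hst := stateAt_succ_inform ht htL (hinv v)
  have hdec : (stateAt c W ω (t + 1) v).decided = (stateAt c W ω t v).decided := by
    rw [hst, receiveInform]
    split_ifs <;> rfl
  have hjoined : ∀ k, k ∈ (stateAt c W ω (t + 1) v).joined ↔ k ∈ (stateAt c W ω t v).joined ∨
      ∃ x ∈ greedyJoined c W ω, ∃ u, TreeParent W x u v ∧
        (relays c W ω u v)[t - (stage V + 1)]? = some (W.index 2 u x) ∧ W.index 2 v x = k := by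
    intro k
    rw [← cmpAt_eq_some_eq_iff ht htL hinv, hst, receiveInform]
    split_ifs <;> rfl
  refine ⟨fun hlt => ?_, hdec.trans (hinv v).decided, fun i hi => ?_, fun x hx hvx => ?_,
    fun s hs hs' u hu x hx hT hk => ?_⟩
  · have hne : t ≠ 2 * stageLength (W.localView 2 v).n := fun h => by
      have : t = 2 * stage V := h
      omega
    rw [hst, receiveInform, if_neg hne]
    exact (hinv v).not_halted htL
  · rcases (hjoined i).1 hi with h | ⟨x, hx, u, hT, -, rfl⟩
    · exact (hinv v).exists_of_mem i h
    · exact ⟨x, hx, W.edist_le_two_of_adj_adj hT.2.1.symm hT.1, rfl⟩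
  · exact (hjoined _).2 (.inl ((hinv v).mem_of_adj x hx hvx))
  · rcases Nat.lt_succ_iff_lt_or_eq.1 hs' with h | rfl
    · exact (hjoined _).2 (.inl ((hinv v).mem_of_relays s hs h u hu x hx hT hk))
    · exact (hjoined _).2 (.inr ⟨x, hx, u, hT, hk, rfl⟩)

theorem informInv (ht : stage V < t) (htL : t ≤ 2 * stage V + 1) (v : V) :
    InformInv c W ω t v := by
  induction t, ht using Nat.le_induction generalizing v with
  | base => exact informInv_start v
  | succ t ht ih => exact informInv_succ ht (by omega) (ih (by omega)) v

/-- The first round of Luby's algorithm. -/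
noncomputable abbrev lubyStart (V : Type*) [Fintype V] : ℕ := 2 * stage V + 1

theorem informInv_lubyStart (v : V) : InformInv c W ω (lubyStart V) v :=
  informInv (by have := stage_pos (V := V); omega) le_rfl v

theorem stateAt_lubyStart (v : V) :
    ((stateAt c W ω (lubyStart V) v).halted ↔ (stateAt c W ω (lubyStart V) v).decided ≠ none) ∧
      (stateAt c W ω (lubyStart V) v).active = {i | (W.localView 2 v).adj (W.localView 2 v).self i ∧
        ∀ k ∈ (stateAt c W ω (lubyStart V) v).joined, ¬ (W.localView 2 v).adj i k} := by
  have hpos := stage_pos (V := V)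
  have ht : stage V < 2 * stage V := by omega
  have hst := stateAt_succ_inform ht le_rfl (informInv (c := c) (W := W) (ω := ω) ht (by omega) v)
  have h : 2 * stage V = 2 * stageLength (W.localView 2 v).n := rfl
  rw [receiveInform, if_pos h] at hst
  rw [hst]
  exact ⟨Iff.rfl, rfl⟩

theorem mem_remnant_iff :
    v ∈ remnant c W ω ↔ v ∈ undominated W.graph (greedyJoined c W ω) := by
  rw [← greedyDecision_eq_none_iff, ← (informInv_lubyStart v).decided]
  rfl

theorem halted_lubyStart_iff : (stateAt c W ω (lubyStart V) v).halted ↔ v ∉ remnant c W ω :=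
  (stateAt_lubyStart v).1

/-- A remnant node has no joined neighbour, so no knowledge about joined nodes can exclude it. No
assumption on the sample enters, which keeps the output correct for every outcome of the random
choices. -/
theorem index_mem_active_lubyStart (hu : u ∈ remnant c W ω)
    (h : W.graph.Adj v u) : W.index 2 v u ∈ (stateAt c W ω (lubyStart V) v).active := by
  rw [(stateAt_lubyStart v).2]
  refine ⟨W.localView_adj_self_index_iff.2 ⟨u, h, rfl⟩, fun k hk hadj => ?_⟩
  obtain ⟨x, hx, hx2, rfl⟩ := (informInv_lubyStart v).exists_of_mem k hk
  rw [W.localView_adj_index (W.edist_le_two_of_adj h) hx2 (.inl (W.edist_le_one_of_adj h))] at hadj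
  exact (mem_remnant_iff.1 hu).2 x hadj hx

theorem length_relays_le (hw : W.graph.Adj v w) :
    (relays c W ω v w).length ≤ (sampledSet c ω).ncard := by
  rw [← List.toFinset_card_of_nodup nodup_relays, ← Set.ncard_coe_finset]
  refine (Set.ncard_le_ncard (t := W.index 2 v '' sampledSet c ω) (fun k hk => ?_)
    (Set.toFinite _)).trans (Set.ncard_image_le (Set.toFinite _))
  obtain ⟨x, rfl, hJ, -⟩ := (mem_relays_iff hw).1 (List.mem_toFinset.1 hk)
  exact ⟨x, greedyJoined_subset hJ, rfl⟩

/-- This converse serves only the message bound. A neighbour `u` of `v` outside the remnant has a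
joined neighbour `x`, at distance two from `v`. The tree parent of `v` relays the ID of `x`; its
position in the list is below the sample size, hence below `L`, so it arrives before the stage ends
and `v` disregards `u`. -/
theorem mem_remnant_of_mem_active_lubyStart (hS : (sampledSet c ω).ncard ≤ stage V)
    (hv : v ∈ remnant c W ω) (h : W.graph.Adj v u)
    (ha : W.index 2 v u ∈ (stateAt c W ω (lubyStart V) v).active) : u ∈ remnant c W ω := by
  rw [(stateAt_lubyStart v).2] at ha
  have hv' := mem_remnant_iff.1 hv
  rw [mem_remnant_iff, ← greedyDecision_eq_none_iff]
  rcases hd : greedyDecision c W ω (stage V + 1) u with _ | _ | _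
  · rfl
  · obtain ⟨x, hux, hx⟩ := exists_mem_greedyJoined_of_eq_some_false hd
    have hx2 := W.edist_le_two_of_adj_adj h hux
    have hne : v ≠ x := fun he => hv'.1 (he ▸ hx)
    obtain ⟨y, hT⟩ := exists_treeParent hx2 hne fun hadj => hv'.2 x hadj hx
    obtain ⟨p, hp, hk⟩ := List.mem_iff_getElem.1
      ((mem_relays_iff (c := c) (ω := ω) hT.2.1).2 ⟨x, rfl, hx, hT⟩)
    have hlen := length_relays_le (c := c) (ω := ω) hT.2.1
    refine absurd ((W.localView_adj_index (W.edist_le_two_of_adj h) hx2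
      (.inl (W.edist_le_one_of_adj h))).2 hux) (ha.2 _ ?_)
    refine (informInv_lubyStart v).mem_of_relays (stage V + 1 + p) (by omega)
      (by unfold lubyStart; omega) y
      hT.2.1.symm x hx hT ?_
    rw [Nat.add_sub_cancel_left, ← hk]
    exact List.getElem?_eq_getElem hp
  · exact absurd hd (hv'.2 u h)

end Inform

end KT2MIS

/-! ### Luby's algorithm -/

section Luby

variable {V : Type*} {α : Type*} [LinearOrder α]

/-- The local maxima. -/
def lubyWinners (G : SimpleGraph V) (key : V → α) (A : Set V) : Set V :=
  {v | v ∈ A ∧ ∀ u, G.Adj v u → u ∈ A → key u < key v}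

/-- The nodes of `A` that remain after a phase of Luby's algorithm. -/
def lubyStep (G : SimpleGraph V) (key : V → α) (A : Set V) : Set V :=
  A ∩ undominated G (lubyWinners G key A)

variable {G : SimpleGraph V} {key : V → α} {A : Set V}

theorem lubyWinners_subset : lubyWinners G key A ⊆ A := fun _ h => h.1

theorem lubyStep_subset : lubyStep G key A ⊆ A := fun _ h => h.1

theorem not_adj_of_mem_lubyWinners {v u : V} (hv : v ∈ lubyWinners G key A)
    (hu : u ∈ lubyWinners G key A) : ¬ G.Adj v u := fun h =>
  lt_asymm (hv.2 u h hu.1) (hu.2 v h.symm hv.1)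

theorem lubyStep_ssubset [Finite V] (hk : Function.Injective key) (hA : A.Nonempty) :
    lubyStep G key A ⊂ A := by
  obtain ⟨m, hm, hmax⟩ := Set.exists_max_image A key (Set.toFinite _) hA
  have hw : m ∈ lubyWinners G key A :=
    ⟨hm, fun u hu huA => lt_of_le_of_ne (hmax u huA) fun h => hu.ne (hk h).symm⟩
  exact lubyStep_subset.ssubset_of_mem_notMem hm fun h => h.2.1 hw

theorem lubyStep_eq_empty (h : ∀ v ∈ A, ∀ u ∈ A, ¬ G.Adj v u) : lubyStep G key A = ∅ :=
  Set.eq_empty_of_forall_notMem fun v hv =>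
    hv.2.1 ⟨hv.1, fun u hu huA => absurd hu (h v hv.1 u huA)⟩

end Luby

/-! ### Luby's algorithm in the execution -/

namespace KT2MIS

section Luby

open scoped Classical

variable {V : Type*} [Fintype V] {N : ℕ} {c : ℝ} {W : Network V N} {ω : V × ℕ → unitInterval}
  {t j l : ℕ} {v u w x : V}

variable (W ω) in
/-- The nodes that remain after `j` phases of Luby's algorithm that starts on `A`. -/
noncomputable def lubySet (A : Set V) : ℕ → Set V
  | 0 => A
  | j + 1 => lubyStep W.graph (W.key (rank ω (j + 2))) (lubySet A j)

theorem lubySet_antitone (A : Set V) : Antitone (lubySet W ω A) :=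
  antitone_nat_of_succ_le fun _ => lubyStep_subset

theorem ncard_lubySet_add_le (A : Set V) (h : (lubySet W ω A j).Nonempty) :
    (lubySet W ω A j).ncard + j ≤ Fintype.card V := by
  induction j with
  | zero => exact (Set.ncard_le_card _).trans Nat.card_eq_fintype_card.le
  | succ j ih =>
    have hne := h.mono (lubySet_antitone A j.le_succ)
    have h1 := ih hne
    have h2 : (lubySet W ω A (j + 1)).ncard < (lubySet W ω A j).ncard :=
      Set.ncard_lt_ncard (lubyStep_ssubset (W.key_injective _) hne) (Set.toFinite _)
    omega

theorem lubySet_card_eq_empty (A : Set V) : lubySet W ω A (Fintype.card V) = ∅ := by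
  by_contra h
  have hne := Set.nonempty_iff_ne_empty.2 h
  have := ncard_lubySet_add_le A hne
  have := (Set.ncard_pos (Set.toFinite _)).2 hne
  omega

variable (c W ω) in
/-- The state before phase `j` of Luby's algorithm. -/
structure LubyInv (j : ℕ) : Prop where
  halted_iff : ∀ v, (stateAt c W ω (lubyStart V + 3 * j) v).halted ↔
    v ∉ lubySet W ω (remnant c W ω) j
  decided_eq_none_iff : ∀ v, (stateAt c W ω (lubyStart V + 3 * j) v).decided = none ↔
    v ∈ lubySet W ω (remnant c W ω) j
  -- Only one inclusion is required: superfluous active neighbours have halted, so they stay silent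
  -- and ignore what they receive.
  active : ∀ v ∈ lubySet W ω (remnant c W ω) j, ∀ u ∈ lubySet W ω (remnant c W ω) j,
    W.graph.Adj v u → W.index 2 v u ∈ (stateAt c W ω (lubyStart V + 3 * j) v).active
  not_adj : ∀ v u, (stateAt c W ω (lubyStart V + 3 * j) v).decided = some true →
    W.graph.Adj v u → (stateAt c W ω (lubyStart V + 3 * j) u).decided = some false
  exists_adj : ∀ v, (stateAt c W ω (lubyStart V + 3 * j) v).decided = some false →
    ∃ u, W.graph.Adj v u ∧ (stateAt c W ω (lubyStart V + 3 * j) u).decided = some true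

theorem lubyInv_zero : LubyInv c W ω 0 where
  halted_iff _ := halted_lubyStart_iff
  decided_eq_none_iff _ := Iff.rfl
  active _ _ _ hu h := index_mem_active_lubyStart hu h
  not_adj v u hv h := by
    have hd := fun v => (informInv_lubyStart (c := c) (W := W) (ω := ω) v).decided
    rw [Nat.mul_zero, Nat.add_zero, hd] at hv ⊢
    rcases hu : greedyDecision c W ω (stage V + 1) u with _ | _ | _
    · exact absurd hv ((greedyDecision_eq_none_iff.1 hu).2 v h.symm)
    · rfl
    · exact absurd h (not_adj_of_mem_greedyJoined hv hu)
  exists_adj v hv := by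
    have hd := fun v => (informInv_lubyStart (c := c) (W := W) (ω := ω) v).decided
    simp only [Nat.mul_zero, Nat.add_zero, hd] at hv ⊢
    exact exists_mem_greedyJoined_of_eq_some_false hv

theorem sent_luby {m : Message N} : (algorithm c).sent W 2 ω (lubyStart V + l) v u = some m ↔
    W.graph.Adj v u ∧ ¬ (stateAt c W ω (lubyStart V + l) v).halted ∧
      ∃ q, sendLuby (W.localView 2 v) (CompAlgorithm.tapeOf ω v) l
        (stateAt c W ω (lubyStart V + l) v) (W.index 2 v u) = some q ∧
      (⟨q.1, q.2.filterMap ((algorithm c).config W 2 ω (lubyStart V + l) v).var⟩ : Message N) =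
        m := by
  have h1 : ¬ lubyStart V + l ≤ stageLength (W.localView 2 v).n := by
    change ¬ 2 * stage V + 1 + l ≤ stage V
    omega
  have h2 : ¬ lubyStart V + l ≤ 2 * stageLength (W.localView 2 v).n := by
    change ¬ 2 * stage V + 1 + l ≤ 2 * stage V
    omega
  have h3 : lubyStart V + l - (2 * stageLength (W.localView 2 v).n + 1) = l :=
    Nat.add_sub_cancel_left ..
  rw [sent_eq_some_iff]
  simp only [send, if_neg h1, if_neg h2, h3]

theorem stateAt_succ_luby (h : ¬ (stateAt c W ω (lubyStart V + l) v).halted) :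
    stateAt c W ω (lubyStart V + l + 1) v =
      receiveLuby (W.localView 2 v) (CompAlgorithm.tapeOf ω v) l
        (inboxAt c W ω (lubyStart V + l) v) (stateAt c W ω (lubyStart V + l) v) := by
  have h1 : ¬ lubyStart V + l ≤ stageLength (W.localView 2 v).n := by
    change ¬ 2 * stage V + 1 + l ≤ stage V
    omega
  have h2 : ¬ lubyStart V + l ≤ 2 * stageLength (W.localView 2 v).n := by
    change ¬ 2 * stage V + 1 + l ≤ 2 * stage V
    omega
  have h3 : lubyStart V + l - (2 * stageLength (W.localView 2 v).n + 1) = l :=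
    Nat.add_sub_cancel_left ..
  rw [stateAt_succ h, receive, if_neg h1, if_neg h2, h3]

section Phase

variable (hinv : LubyInv c W ω j)
include hinv

theorem stateAt_of_notMem_lubySet (hv : v ∉ lubySet W ω (remnant c W ω) j)
    (r : ℕ) : stateAt c W ω (lubyStart V + 3 * j + r) v = stateAt c W ω (lubyStart V + 3 * j) v := by
  induction r with
  | zero => rfl
  | succ r ih =>
    refine (stateAt_succ_of_halted (t := lubyStart V + 3 * j + r) ?_).trans ih
    rw [ih]
    exact (hinv.halted_iff v).2 hv

theorem stateAt_phase_one (hv : v ∈ lubySet W ω (remnant c W ω) j) :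
    stateAt c W ω (lubyStart V + 3 * j + 1) v =
      { stateAt c W ω (lubyStart V + 3 * j) v with
        decided := if v ∈ lubyWinners W.graph (W.key (rank ω (j + 2)))
          (lubySet W ω (remnant c W ω) j) then some true else none } := by
  have hnh := fun h => (hinv.halted_iff v).1 h hv
  have hmax := localMax_iff (W := W) (v := v) (r := rank ω (j + 2))
    (others := fun i => (inboxAt c W ω (lubyStart V + 3 * j) v i).map Prod.fst)
    -- The inbox holds exactly the random numbers of the remaining neighbours: halted nodes are
    -- silent, and remaining neighbours regard each other as active.
    (P := fun u => u ∈ lubySet W ω (remnant c W ω) j) fun i r' => by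
      rw [Option.map_eq_some_iff]
      constructor
      · rintro ⟨p, hp, rfl⟩
        obtain ⟨u, m, hu, hi, hm, rfl⟩ := inboxAt_eq_some_iff.1 hp
        obtain ⟨-, hh, q, hq, rfl⟩ := sent_luby.1 hm
        rw [hinv.halted_iff, not_not] at hh
        refine ⟨u, hu, hi, hh, ?_⟩
        simp only [sendLuby, Nat.mul_mod_right, if_true] at hq
        split_ifs at hq
        obtain rfl := Option.some_injective _ hq
        simp [lubyRank_eq]
      · rintro ⟨u, hu, hi, huA, rfl⟩
        refine ⟨(rank ω (j + 2) u, 0), inboxAt_eq_some_iff.2 ⟨u, ⟨rank ω (j + 2) u, []⟩, hu, hi,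
          sent_luby.2 ⟨hu.symm, fun h => (hinv.halted_iff u).1 h huA, (rank ω (j + 2) u, []), ?_,
            rfl⟩, rfl⟩, rfl⟩
        simp [sendLuby, hinv.active u huA v hv hu.symm, lubyRank_eq]
  rw [stateAt_succ_luby hnh, receiveLuby, if_pos (Nat.mul_mod_right _ _),
    Nat.mul_div_cancel_left _ (by norm_num)]
  congr 1
  rw [lubyRank_eq, (hinv.decided_eq_none_iff v).2 hv]
  refine if_congr ?_ rfl rfl
  rw [hmax]
  exact ⟨fun h => ⟨hv, h⟩, fun h => h.2⟩

theorem stateAt_phase_two (hv : v ∈ lubySet W ω (remnant c W ω) j) :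
    stateAt c W ω (lubyStart V + 3 * j + 2) v =
      if v ∈ lubyWinners W.graph (W.key (rank ω (j + 2))) (lubySet W ω (remnant c W ω) j) then
        { stateAt c W ω (lubyStart V + 3 * j) v with
          decided := some true
          halted := True }
      else
        { stateAt c W ω (lubyStart V + 3 * j) v with
          decided := if ∃ u, W.graph.Adj v u ∧ u ∈ lubyWinners W.graph
            (W.key (rank ω (j + 2))) (lubySet W ω (remnant c W ω) j) then some false else none } := by
  have hnh := fun h => (hinv.halted_iff v).1 h hv
  have h1 := stateAt_phase_one hinv hv
  have hnh1 : ¬ (stateAt c W ω (lubyStart V + (3 * j + 1)) v).halted := by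
    rw [← add_assoc, h1]
    exact hnh
  have hmod : (3 * j + 1) % 3 = 1 := by omega
  have hmod0 : ¬ (3 * j + 1) % 3 = 0 := by omega
  have hin : (∃ i, (inboxAt c W ω (lubyStart V + (3 * j + 1)) v i).isSome) ↔
      ∃ u, W.graph.Adj v u ∧ u ∈ lubyWinners W.graph
        (W.key (rank ω (j + 2))) (lubySet W ω (remnant c W ω) j) := by
    simp only [inboxAt_isSome_iff]
    constructor
    · rintro ⟨i, u, hu, -, hs⟩
      obtain ⟨m, hm⟩ := Option.isSome_iff_exists.1 hs
      obtain ⟨-, hh, q, hq, -⟩ := sent_luby.1 hm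
      refine ⟨u, hu, ?_⟩
      have huA : u ∈ lubySet W ω (remnant c W ω) j := by
        by_contra huA
        rw [← add_assoc, stateAt_of_notMem_lubySet hinv huA 1] at hh
        exact hh ((hinv.halted_iff u).2 huA)
      rw [sendLuby, ← add_assoc, stateAt_phase_one hinv huA] at hq
      by_contra hW
      simp [hmod, hW] at hq
    · rintro ⟨u, hu, hW⟩
      have huA := lubyWinners_subset hW
      have h1u := stateAt_phase_one hinv huA
      refine ⟨_, u, hu, rfl, Option.isSome_iff_exists.2 ⟨_, sent_luby.2 ⟨hu.symm, ?_, (1, []), ?_,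
        rfl⟩⟩⟩
      · rw [← add_assoc, h1u]
        exact fun h => (hinv.halted_iff u).1 h huA
      · rw [sendLuby, ← add_assoc, h1u]
        simp [hmod, hW, hinv.active u huA v hv hu.symm]
  have h2 := stateAt_succ_luby hnh1
  rw [receiveLuby, if_neg hmod0, if_pos hmod] at h2
  change stateAt c W ω (lubyStart V + (3 * j + 1) + 1) v = _
  rw [h2, ← add_assoc, h1]
  rw [← add_assoc] at hin
  by_cases hW : v ∈ lubyWinners W.graph (W.key (rank ω (j + 2))) (lubySet W ω (remnant c W ω) j)
  · simp [hW]
  · simp only [hW, if_false, reduceCtorEq, hin]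

theorem stateAt_phase_three (hv : v ∈ lubySet W ω (remnant c W ω) j) :
    (stateAt c W ω (lubyStart V + 3 * (j + 1)) v).decided =
        (if v ∈ lubyWinners W.graph (W.key (rank ω (j + 2))) (lubySet W ω (remnant c W ω) j) then
          some true
        else if ∃ u, W.graph.Adj v u ∧ u ∈ lubyWinners W.graph
            (W.key (rank ω (j + 2))) (lubySet W ω (remnant c W ω) j) then some false else none) ∧
      ((stateAt c W ω (lubyStart V + 3 * (j + 1)) v).halted ↔
        v ∉ lubySet W ω (remnant c W ω) (j + 1)) ∧
      (v ∈ lubySet W ω (remnant c W ω) (j + 1) →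
        ∀ u ∈ lubySet W ω (remnant c W ω) (j + 1), W.graph.Adj v u →
          W.index 2 v u ∈ (stateAt c W ω (lubyStart V + 3 * (j + 1)) v).active) := by
  have hstep : ∀ u, u ∈ lubySet W ω (remnant c W ω) (j + 1) ↔
      u ∈ lubySet W ω (remnant c W ω) j ∧ u ∈ undominated W.graph
        (lubyWinners W.graph (W.key (rank ω (j + 2))) (lubySet W ω (remnant c W ω) j)) :=
    fun u => Iff.rfl
  have h2 : ∀ u ∈ lubySet W ω (remnant c W ω) j, _ := fun u hu => stateAt_phase_two hinv hu
  set O := lubyWinners W.graph (W.key (rank ω (j + 2))) (lubySet W ω (remnant c W ω) j)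
  have hnh := fun h => (hinv.halted_iff v).1 h hv
  have hmod : (3 * j + 2) % 3 = 2 := by omega
  have e : lubyStart V + 3 * (j + 1) = lubyStart V + (3 * j + 2) + 1 := by ring
  have e2 : lubyStart V + 3 * j + 2 = lubyStart V + (3 * j + 2) := by ring
  rw [e2] at h2
  by_cases hW : v ∈ O
  · have h3 : stateAt c W ω (lubyStart V + (3 * j + 2) + 1) v = _ :=
      stateAt_succ_of_halted (by simp [h2 v hv, hW])
    rw [e, h3, h2 v hv, if_pos hW]
    refine ⟨by simp [hW], ?_, fun h => absurd hW ((hstep v).1 h).2.1⟩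
    simp only [true_iff]
    exact fun h => ((hstep v).1 h).2.1 hW
  · have h3 := stateAt_succ_luby (c := c) (W := W) (ω := ω) (l := 3 * j + 2) (v := v)
      (by simpa [h2 v hv, hW] using hnh)
    rw [receiveLuby, if_neg (by omega), if_neg (by omega)] at h3
    by_cases hN : ∃ u, W.graph.Adj v u ∧ u ∈ O
    · rw [if_pos (by simp [h2 v hv, hW, hN])] at h3
      rw [e, h3]
      refine ⟨by simp [h2 v hv, hW], ?_, fun h => ?_⟩
      · simp only [true_iff]
        rintro h
        obtain ⟨u, hu, huO⟩ := hN
        exact ((hstep v).1 h).2.2 u hu huO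
      · obtain ⟨u, hu, huO⟩ := hN
        exact absurd huO (((hstep v).1 h).2.2 u hu)
    · rw [if_neg (by simp [h2 v hv, hW, hN])] at h3
      have hmem : v ∈ lubySet W ω (remnant c W ω) (j + 1) :=
        (hstep v).2 ⟨hv, hW, fun u hu huO => hN ⟨u, hu, huO⟩⟩
      rw [e, h3]
      refine ⟨by simp [h2 v hv, hW], ?_, fun _ u hu hvu => ⟨?_, ?_⟩⟩
      · simp only [hmem, not_true, iff_false]
        simpa [h2 v hv, hW] using hnh
      · simpa [h2 v hv, hW] using hinv.active v hv u (lubyStep_subset hu) hvu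
      -- Only a node that has just lost to a neighbouring winner sends in the third round of a
      -- phase, and a node that survives the phase is not such a node.
      · by_contra hne
        obtain ⟨u', hu', hi, hs⟩ := inboxAt_isSome_iff.1 (Option.isSome_iff_ne_none.2 hne)
        obtain rfl := W.index_injOn (W.edist_le_two_of_adj hu') (W.edist_le_two_of_adj hvu) hi
        obtain ⟨m, hm⟩ := Option.isSome_iff_exists.1 hs
        obtain ⟨-, -, q, hq, -⟩ := sent_luby.1 hm
        obtain ⟨huA, huO, huN⟩ := (hstep u').1 hu
        have hN' : ¬ ∃ x, W.graph.Adj u' x ∧ x ∈ O := fun ⟨x, hx, hxO⟩ => huN x hx hxO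
        simp [sendLuby, hmod, h2 u' huA, huO, hN'] at hq

theorem lubyInv_succ : LubyInv c W ω (j + 1) := by
  have hin := fun v (hv : v ∈ lubySet W ω (remnant c W ω) j) => stateAt_phase_three hinv hv
  have hout := fun v (hv : v ∉ lubySet W ω (remnant c W ω) j) =>
    stateAt_of_notMem_lubySet hinv hv 3
  have hstep : ∀ u, u ∈ lubySet W ω (remnant c W ω) (j + 1) ↔
      u ∈ lubySet W ω (remnant c W ω) j ∧ u ∈ undominated W.graph
        (lubyWinners W.graph (W.key (rank ω (j + 2))) (lubySet W ω (remnant c W ω) j)) :=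
    fun u => Iff.rfl
  have e : lubyStart V + 3 * j + 3 = lubyStart V + 3 * (j + 1) := by ring
  rw [e] at hout
  -- Halted nodes are frozen, so the computed set grows exactly by the winners of the phase.
  have htrue : ∀ v, (stateAt c W ω (lubyStart V + 3 * (j + 1)) v).decided = some true ↔
      v ∈ lubyWinners W.graph (W.key (rank ω (j + 2))) (lubySet W ω (remnant c W ω) j) ∨
      (stateAt c W ω (lubyStart V + 3 * j) v).decided = some true := by
    intro v
    by_cases hv : v ∈ lubySet W ω (remnant c W ω) j
    · rw [(hin v hv).1, (hinv.decided_eq_none_iff v).2 hv]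
      split_ifs <;> simp_all
    · rw [hout v hv]
      exact ⟨.inr, fun h => h.resolve_left fun h => hv h.1⟩
  refine ⟨fun v => ?_, fun v => ?_, fun v hv => ?_, fun v u hv hvu => ?_, fun v hv => ?_⟩
  · by_cases hv : v ∈ lubySet W ω (remnant c W ω) j
    · exact (hin v hv).2.1
    · rw [hout v hv, hinv.halted_iff, hstep]
      tauto
  · by_cases hv : v ∈ lubySet W ω (remnant c W ω) j
    · rw [(hin v hv).1, hstep]
      split_ifs with h1 h2
      · simp [undominated, h1]
      · obtain ⟨u, hu, huO⟩ := h2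
        simp only [false_iff]
        exact fun h => h.2.2 u hu huO
      · simp only [hv, true_and, true_iff]
        exact ⟨h1, fun u hu huO => h2 ⟨u, hu, huO⟩⟩
    · rw [hout v hv, hinv.decided_eq_none_iff, hstep]
      tauto
  · exact (hin v (lubyStep_subset hv)).2.2 hv
  · rcases (htrue v).1 hv with h | h
    · by_cases hu : u ∈ lubySet W ω (remnant c W ω) j
      · rw [(hin u hu).1, if_neg fun hu' => not_adj_of_mem_lubyWinners h hu' hvu,
          if_pos ⟨v, hvu.symm, h⟩]
      · rw [hout u hu]
        rcases hd : (stateAt c W ω (lubyStart V + 3 * j) u).decided with _ | _ | _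
        · exact absurd ((hinv.decided_eq_none_iff u).1 hd) hu
        · rfl
        · have := hinv.not_adj u v hd hvu.symm
          rw [(hinv.decided_eq_none_iff v).2 h.1] at this
          cases this
    · have hu := hinv.not_adj v u h hvu
      rwa [hout u fun hu' => ?_]
      rw [(hinv.decided_eq_none_iff u).2 hu'] at hu
      cases hu
  · simp only [htrue]
    by_cases hv' : v ∈ lubySet W ω (remnant c W ω) j
    · rw [(hin v hv').1] at hv
      split_ifs at hv with h1 h2
      · cases hv
      · obtain ⟨u, hu, huO⟩ := h2
        exact ⟨u, hu, .inl huO⟩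
    · rw [hout v hv'] at hv
      obtain ⟨u, hu, hut⟩ := hinv.exists_adj v hv
      exact ⟨u, hu, .inr hut⟩

end Phase

theorem lubyInv (j : ℕ) : LubyInv c W ω j := by
  induction j with
  | zero => exact lubyInv_zero
  | succ j ih => exact lubyInv_succ ih

theorem haltedBy_iff : (algorithm c).HaltedBy W 2 ω (lubyStart V + 3 * j) ↔
    lubySet W ω (remnant c W ω) j = ∅ := by
  rw [Set.eq_empty_iff_forall_notMem]
  exact forall_congr' fun v => (lubyInv j).halted_iff v

theorem haltedBy_card : (algorithm c).HaltedBy W 2 ω (lubyStart V + 3 * Fintype.card V) :=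
  haltedBy_iff.2 (lubySet_card_eq_empty _)

theorem maximal_isIndepSet_outputSet (h : (algorithm c).HaltedBy W 2 ω t) :
    Maximal W.graph.IsIndepSet ((algorithm c).outputSet W 2 ω t) := by
  have hcard := haltedBy_card (c := c) (W := W) (ω := ω)
  -- The output no longer changes once all nodes have halted, so it can be read off after `n`
  -- phases, where no node is undecided and the invariant gives independence and domination.
  have heq : (algorithm c).outputSet W 2 ω t =
      (algorithm c).outputSet W 2 ω (lubyStart V + 3 * Fintype.card V) := by
    rcases le_total t (lubyStart V + 3 * Fintype.card V) with hle | hle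
    · exact (h.outputSet_eq _ W ω hle).symm
    · exact hcard.outputSet_eq _ W ω hle
  rw [heq]
  have hinv := lubyInv (c := c) (W := W) (ω := ω) (Fintype.card V)
  refine ⟨fun v hv u hu _ hvu => ?_, fun s hs hle v hv => ?_⟩
  · have := (hinv.not_adj v u hv hvu).symm.trans hu
    cases this
  · rcases hd : (stateAt c W ω (lubyStart V + 3 * Fintype.card V) v).decided with _ | _ | _
    · rw [hinv.decided_eq_none_iff, lubySet_card_eq_empty] at hd
      exact hd.elim
    · obtain ⟨u, hu, hut⟩ := hinv.exists_adj v hd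
      exact absurd hu (hs hv (hle hut) hu.ne)
    · exact hd

end Luby

end KT2MIS

/-! ### The sizes and the number of the messages -/

namespace KT2MIS

section Messages

open scoped Classical

variable {V : Type*} [Fintype V] {N : ℕ} {c : ℝ} {W : Network V N} {ω : V × ℕ → unitInterval}
  {t : ℕ} {v u : V}

theorem rank_le (k : ℕ) (v : V) : rank ω k v ≤ Fintype.card V ^ 4 := by
  refine Nat.floor_le_of_le ?_
  push_cast
  exact mul_le_of_le_one_left (by positivity) (ω (v, k)).2.2

theorem exists_eq_lubyStart_add (h : ¬ t ≤ 2 * stage V) : ∃ l, t = lubyStart V + l :=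
  Nat.exists_eq_add_of_le (by unfold lubyStart; omega)

theorem ord_le_and_length_le {m : Message N} (h : (algorithm c).sent W 2 ω t v u = some m) :
    m.ord ≤ Fintype.card V ^ 4 ∧ m.ids.length ≤ 1 := by
  have h1 : 1 ≤ Fintype.card V ^ 4 := Nat.one_le_pow _ _ (Fintype.card_pos_iff.2 ⟨v⟩)
  by_cases ht : t ≤ stage V
  · by_cases ht0 : t = 0
    · subst ht0
      obtain ⟨-, -, rfl⟩ := sent_zero.1 h
      exact ⟨rank_le 1 v, by simp⟩
    · obtain ⟨-, -, -, -, rfl⟩ := (sent_greedy ht0 ht (greedyInv (by omega) v)).1 h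
      refine ⟨?_, by simp⟩
      change (if _ then 1 else 0) ≤ _
      split_ifs <;> omega
  by_cases htL : t ≤ 2 * stage V
  · obtain ⟨x, -, -, -, rfl⟩ :=
      (sent_inform (not_le.1 ht) htL (informInv (not_le.1 ht) (by omega) v)).1 h
    exact ⟨Nat.zero_le _, le_rfl⟩
  obtain ⟨l, rfl⟩ := exists_eq_lubyStart_add htL
  obtain ⟨-, -, q, hq, rfl⟩ := sent_luby.1 h
  unfold sendLuby at hq
  split_ifs at hq <;> obtain rfl := Option.some_injective _ hq
  · exact ⟨rank_le _ v, by simp⟩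
  · exact ⟨h1, by simp⟩
  · exact ⟨Nat.zero_le _, by simp⟩

theorem size_le_log {n : ℕ} (hn : 2 ≤ n) : (Nat.size n : ℝ) ≤ 2 / Real.log 2 * Real.log n := by
  have hlog2 : 0 < Real.log 2 := Real.log_pos one_lt_two
  have hn' : (2 : ℝ) ≤ n := by exact_mod_cast hn
  have hsz : 0 < Nat.size n := Nat.size_pos.2 (by omega)
  have h1 : (2 : ℝ) ^ (Nat.size n - 1) ≤ n := by
    exact_mod_cast Nat.lt_size.1 (Nat.sub_lt hsz one_pos)
  have h2 := Real.log_le_log (by positivity) h1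
  have h3 := Real.log_le_log (by norm_num) hn'
  rw [Real.log_pow, Nat.cast_sub hsz] at h2
  rw [div_mul_eq_mul_div, le_div_iff₀ hlog2]
  push_cast at h2
  linarith

theorem bits_le {n κ : ℕ} {W : Network (Fin n) N} {ω : Fin n × ℕ → unitInterval} {v u : Fin n}
    (hN : N ≤ n ^ κ) {m : Message N} (h : (algorithm c).sent W 2 ω t v u = some m) :
    (m.bits : ℝ) ≤ (4 + κ) * (2 / Real.log 2) * Real.log n := by
  obtain ⟨ho, hl⟩ := ord_le_and_length_le h
  rw [Fintype.card_fin] at ho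
  have hne := (sent_eq_some_iff.1 h).1.ne
  -- Sender and receiver are distinct; this excludes `n = 1`, where `Real.log n` vanishes.
  have hn : 2 ≤ n := by
    have := v.isLt
    have := u.isLt
    have : (v : ℕ) ≠ u := fun h => hne (Fin.ext h)
    omega
  have hlt := Nat.lt_size_self n
  have h1 : Nat.size m.ord ≤ 4 * Nat.size n := by
    rw [Nat.size_le, pow_mul']
    exact ho.trans_lt (Nat.pow_lt_pow_left hlt (by norm_num))
  have h2 : Nat.clog 2 N ≤ κ * Nat.size n := by
    refine Nat.clog_le_of_le_pow ?_
    rw [pow_mul']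
    exact hN.trans (Nat.pow_le_pow_left hlt.le _)
  have h3 : m.bits ≤ (4 + κ) * Nat.size n := by
    unfold Message.bits
    nlinarith [Nat.mul_le_mul_right (Nat.clog 2 N) hl]
  calc (m.bits : ℝ) ≤ (4 + κ) * Nat.size n := by exact_mod_cast h3
    _ ≤ (4 + κ) * (2 / Real.log 2 * Real.log n) := by
      gcongr
      exact size_le_log hn
    _ = _ := by ring

variable (c W ω) in
/-- The pairs `(v, w)` such that `v` sends a message to `w` in round `t`. -/
noncomputable def sentPairs (t : ℕ) : Finset (V × V) :=
  Finset.univ.filter fun p => ((algorithm c).sent W 2 ω t p.1 p.2).isSome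

theorem mem_sentPairs {p : V × V} : p ∈ sentPairs c W ω t ↔
    ∃ m, (algorithm c).sent W 2 ω t p.1 p.2 = some m := by
  simp [sentPairs, Option.isSome_iff_exists]

theorem messageCount_eq (T : ℕ) :
    (algorithm c).messageCount W 2 ω T = ∑ t ∈ Finset.range T, (sentPairs c W ω t).card := by
  refine Finset.sum_congr rfl fun t _ => ?_
  rw [← Set.ncard_coe_finset]
  congr 1
  ext p
  simp [sentPairs]

theorem messageCount_le (T : ℕ) :
    (algorithm c).messageCount W 2 ω T ≤ T * Fintype.card V ^ 2 := by
  rw [messageCount_eq]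
  refine (Finset.sum_le_card_nsmul _ _ (Fintype.card V ^ 2) fun t _ => ?_).trans (by simp)
  refine (Finset.card_le_univ _).trans ?_
  rw [Fintype.card_prod, sq]

variable (c W ω) in
/-- The sampled nodes that are decided before round `t` of the greedy stage. -/
noncomputable def decidedSamples (t : ℕ) : Finset V :=
  Finset.univ.filter fun v => v ∈ sampledSet c ω ∧ greedyDecision c W ω t v ≠ none

theorem card_decidedSamples_le (t : ℕ) :
    (decidedSamples c W ω t).card ≤ (sampledSet c ω).ncard := by
  rw [← Set.ncard_coe_finset]
  refine Set.ncard_le_ncard (fun v hv => ?_) (Set.toFinite _)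
  exact ((Finset.mem_filter.1 hv).2).1

/-- The senders of round `t + 1` are the sampled nodes newly decided in round `t`. The inequality
telescopes, so all announcements together cost one broadcast per sampled node. -/
theorem card_sentPairs_greedy_le (ht : t < stage V) :
    (sentPairs c W ω (t + 1)).card + (decidedSamples c W ω t).card * Fintype.card V ≤
      (decidedSamples c W ω (t + 1)).card * Fintype.card V := by
  have hsub : decidedSamples c W ω t ⊆ decidedSamples c W ω (t + 1) := fun v hv => by
    obtain ⟨-, h1, h2⟩ := Finset.mem_filter.1 hv
    exact Finset.mem_filter.2 ⟨Finset.mem_univ _, h1,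
      fun h => h2 (greedyProc_eq_none_of_le t.le_succ h)⟩
  rw [← Finset.card_sdiff_add_card_eq_card hsub, add_mul]
  refine Nat.add_le_add_right ?_ _
  rw [← Finset.card_univ, ← Finset.card_product]
  refine Finset.card_le_card fun p hp => ?_
  obtain ⟨m, hm⟩ := mem_sentPairs.1 hp
  obtain ⟨-, h1, h2, h3, -⟩ := (sent_greedy t.succ_ne_zero ht (greedyInv (by omega) p.1)).1 hm
  refine Finset.mem_product.2 ⟨Finset.mem_sdiff.2 ⟨?_, fun h => ?_⟩, Finset.mem_univ _⟩
  · exact Finset.mem_filter.2 ⟨Finset.mem_univ _, h1, h2⟩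
  · exact (Finset.mem_filter.1 h).2.2 h3

theorem sum_card_sentPairs_greedy_le (ht : t ≤ stage V) :
    ∑ s ∈ Finset.range (t + 1), (sentPairs c W ω s).card ≤
      (sampledSet c ω).ncard * Fintype.card V +
        (decidedSamples c W ω t).card * Fintype.card V := by
  induction t with
  | zero =>
    rw [Finset.sum_range_one]
    refine le_add_right ?_
    rw [Set.ncard_eq_toFinset_card', ← Finset.card_univ, ← Finset.card_product]
    refine Finset.card_le_card fun p hp => ?_
    obtain ⟨m, hm⟩ := mem_sentPairs.1 hp
    exact Finset.mem_product.2 ⟨Set.mem_toFinset.2 (sent_zero.1 hm).2.1, Finset.mem_univ _⟩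
  | succ t ih =>
    rw [Finset.sum_range_succ]
    have := ih (by omega)
    have := card_sentPairs_greedy_le (c := c) (W := W) (ω := ω) (Nat.lt_of_succ_le ht)
    omega

/-- Each message is charged to the pair of the joined node it is about and its receiver. This
charging is injective: the sender is the unique tree parent, and the round is the position in a list
without repetitions. -/
theorem sum_card_sentPairs_inform_le :
    ∑ t ∈ Finset.Ico (stage V + 1) (lubyStart V), (sentPairs c W ω t).card ≤
      (sampledSet c ω).ncard * Fintype.card V := by
  rw [← Finset.card_sigma, Set.ncard_eq_toFinset_card', ← Finset.card_univ, ← Finset.card_product]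
  have hex : ∀ y : Σ _ : ℕ, V × V, ∃ x,
      y ∈ (Finset.Ico (stage V + 1) (lubyStart V)).sigma (fun t => sentPairs c W ω t) →
      x ∈ greedyJoined c W ω ∧ TreeParent W x y.2.1 y.2.2 ∧
        (relays c W ω y.2.1 y.2.2)[y.1 - (stage V + 1)]? = some (W.index 2 y.2.1 x) := by
    rintro ⟨t, p⟩
    by_cases hy : (⟨t, p⟩ : Σ _ : ℕ, V × V) ∈
      (Finset.Ico (stage V + 1) (lubyStart V)).sigma (fun t => sentPairs c W ω t)
    swap
    -- An arbitrary value, which makes the choice function total.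
    · exact ⟨p.1, fun h => absurd h hy⟩
    obtain ⟨ht, hp⟩ := Finset.mem_sigma.1 hy
    obtain ⟨ht1, ht2⟩ := Finset.mem_Ico.1 ht
    obtain ⟨m, hm⟩ := mem_sentPairs.1 hp
    have ht2' : t ≤ 2 * stage V := Nat.lt_succ_iff.1 ht2
    obtain ⟨x, hJ, hT, hk, -⟩ := (sent_inform ht1 ht2' (informInv ht1 ht2.le p.1)).1 hm
    exact ⟨x, fun _ => ⟨hJ, hT, hk⟩⟩
  choose x hx using hex
  refine Finset.card_le_card_of_injOn (fun y => (x y, y.2.2)) (fun y hy => ?_) ?_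
  · exact Finset.mem_product.2
      ⟨Set.mem_toFinset.2 (greedyJoined_subset (hx y hy).1), Finset.mem_univ _⟩
  · rintro ⟨t, v, w⟩ hy ⟨t', v', w'⟩ hy' he
    obtain ⟨he1, he2⟩ := Prod.ext_iff.1 he
    simp only at he1 he2
    have hT1 := (hx _ hy).2.1
    have hT2 := (hx _ hy').2.1
    have hk1 := (hx _ hy).2.2
    have hk2 := (hx _ hy').2.2
    have ht := (Finset.mem_Ico.1 (Finset.mem_sigma.1 hy).1).1
    have ht' := (Finset.mem_Ico.1 (Finset.mem_sigma.1 hy').1).1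
    subst he2
    rw [← he1] at hT2 hk2
    obtain rfl : v = v' := hT1.unique hT2
    have := (List.getElem?_inj (List.getElem?_eq_some_iff.1 hk1).1 nodup_relays).1
      (hk1.trans hk2.symm)
    simp only at this ht ht'
    obtain rfl : t = t' := by omega
    rfl

theorem active_subset (l : ℕ) (v : V) : (stateAt c W ω (lubyStart V + l) v).active ⊆
    (stateAt c W ω (lubyStart V) v).active := by
  induction l with
  | zero => exact subset_rfl
  | succ l ih =>
    refine subset_trans ?_ ih
    rw [← add_assoc]
    by_cases h : (stateAt c W ω (lubyStart V + l) v).halted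
    · rw [stateAt_succ_of_halted h]
    · rw [stateAt_succ_luby h, receiveLuby]
      split_ifs
      all_goals first | exact subset_rfl | exact fun i hi => hi.1

theorem not_halted_of_add (l : ℕ) (h : ¬ (stateAt c W ω (lubyStart V + l) v).halted) :
    v ∈ remnant c W ω := by
  by_contra hv
  refine h ?_
  have hh := halted_lubyStart_iff.2 hv
  have : stateAt c W ω (lubyStart V + l) v = stateAt c W ω (lubyStart V) v :=
    congrArg CompAlgorithm.NodeConfig.state
      ((algorithm c).config_of_halted W ω hh (Nat.le_add_right _ l))
  rwa [this]

/-- With a small sample the active neighbours of a remnant node are all in the remnant, so the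
degree in the remnant graph bounds what it sends per round. -/
theorem card_sentPairs_luby_le (hS : (sampledSet c ω).ncard ≤ stage V) {Δ : ℕ}
    (hΔ : ∀ v ∈ remnant c W ω, {w ∈ remnant c W ω | W.graph.Adj v w}.ncard ≤ Δ) (l : ℕ) :
    (sentPairs c W ω (lubyStart V + l)).card ≤ Fintype.card V * Δ := by
  have hsub : sentPairs c W ω (lubyStart V + l) ⊆
      (remnant c W ω).toFinset.biUnion fun v =>
        {v} ×ˢ {w ∈ remnant c W ω | W.graph.Adj v w}.toFinset := by
    rintro ⟨v, w⟩ hp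
    obtain ⟨m, hm⟩ := mem_sentPairs.1 hp
    obtain ⟨hvw, hh, q, hq, -⟩ := sent_luby.1 hm
    have hv := not_halted_of_add l hh
    have ha : W.index 2 v w ∈ (stateAt c W ω (lubyStart V) v).active := by
      refine active_subset l v ?_
      by_contra ha
      simp [sendLuby, ha] at hq
    simp only [Finset.mem_biUnion, Set.mem_toFinset, Finset.mem_product, Finset.mem_singleton]
    exact ⟨v, hv, rfl, mem_remnant_of_mem_active_lubyStart hS hv hvw ha, hvw⟩
  refine (Finset.card_le_card hsub).trans ?_
  refine (Finset.card_biUnion_le_card_mul _ _ Δ fun v hv => ?_).trans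
    (Nat.mul_le_mul_right _ (Finset.card_le_univ _))
  rw [Finset.card_product, Finset.card_singleton, one_mul, ← Set.ncard_eq_toFinset_card']
  exact hΔ v (Set.mem_toFinset.1 hv)

theorem messageCount_lubyStart_add_le (hS : (sampledSet c ω).ncard ≤ stage V) {Δ : ℕ}
    (hΔ : ∀ v ∈ remnant c W ω, {w ∈ remnant c W ω | W.graph.Adj v w}.ncard ≤ Δ) (l : ℕ) :
    (algorithm c).messageCount W 2 ω (lubyStart V + l) ≤
      3 * stage V * Fintype.card V + l * (Fintype.card V * Δ) := by
  rw [messageCount_eq]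
  induction l with
  | zero =>
    rw [Nat.add_zero, Finset.range_eq_Ico, ← Finset.sum_Ico_consecutive _ (Nat.zero_le (stage V + 1))
      (by unfold lubyStart; omega), ← Finset.range_eq_Ico]
    -- The `3` counts the broadcast of ranks, the broadcast of decisions and the relays, each at
    -- most `|S| * n ≤ L * n`.
    have h1 := sum_card_sentPairs_greedy_le (c := c) (W := W) (ω := ω) (le_refl (stage V))
    have h2 := sum_card_sentPairs_inform_le (c := c) (W := W) (ω := ω)
    have h3 := Nat.mul_le_mul_right (Fintype.card V)
      (card_decidedSamples_le (c := c) (W := W) (ω := ω) (stage V))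
    have h4 := Nat.mul_le_mul_right (Fintype.card V) hS
    have h5 : 3 * stage V * Fintype.card V = 3 * (stage V * Fintype.card V) := by ring
    omega
  | succ l ih =>
    rw [← add_assoc, Finset.sum_range_succ, add_mul, one_mul, ← add_assoc]
    exact Nat.add_le_add ih (card_sentPairs_luby_le hS hΔ l)

end Messages

end KT2MIS

/-! ### Probabilities of events about the random tapes -/

section Tapes

variable {V : Type*}

instance : IsProbabilityMeasure (tapeMeasure V) := by
  unfold tapeMeasure
  infer_instance

theorem tapeMeasure_real_inter_of_dependsOn {I J : Finset (V × ℕ)} (hIJ : Disjoint I J)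
    {s t : Set (V × ℕ → unitInterval)} (hs : MeasurableSet s) (ht : MeasurableSet t)
    (hsI : DependsOn (fun ω => ω ∈ s) (I : Set (V × ℕ)))
    (htJ : DependsOn (fun ω => ω ∈ t) (J : Set (V × ℕ))) :
    (tapeMeasure V).real (s ∩ t) = (tapeMeasure V).real s * (tapeMeasure V).real t := by
  classical
  have hind : ProbabilityTheory.iIndepFun (fun i (ω : V × ℕ → unitInterval) => ω i)
      (tapeMeasure V) :=
    ProbabilityTheory.iIndepFun_infinitePi (X := fun _ x => x) fun _ => measurable_id
  have hIJ' := hind.indepFun_finset I J hIJ fun i => measurable_pi_apply i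
  -- Entries outside `K` get the default value `0`, which is immaterial for an event that depends
  -- only on `K`. Such an event is thereby a preimage under restriction to `K`.
  let ext (K : Finset (V × ℕ)) (x : K → unitInterval) (i : V × ℕ) : unitInterval :=
    if h : i ∈ K then x ⟨i, h⟩ else 0
  have hext : ∀ K, Measurable (ext K) := fun K => measurable_pi_iff.2 fun i => by
    by_cases h : i ∈ K
    · simpa [ext, h] using measurable_pi_apply (⟨i, h⟩ : K)
    · simp [ext, h]
  have hpre : ∀ (K : Finset (V × ℕ)) (r : Set (V × ℕ → unitInterval)),
      DependsOn (fun ω => ω ∈ r) (K : Set (V × ℕ)) →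
      (fun (ω : V × ℕ → unitInterval) (i : K) => ω i) ⁻¹' (ext K ⁻¹' r) = r := by
    intro K r hr
    ext ω
    refine Iff.of_eq (hr fun i hi => ?_)
    simp [ext, Finset.mem_coe.1 hi]
  have := hIJ'.measure_inter_preimage_eq_mul _ _ (hext I hs) (hext J ht)
  rw [hpre I s hsI, hpre J t htJ] at this
  simp only [Measure.real, this, ENNReal.toReal_mul]

theorem tapeMeasure_real_forall_mem (k : ℕ) (F : Finset V) {T : V → Set unitInterval}
    (hT : ∀ v, MeasurableSet (T v)) :
    (tapeMeasure V).real {ω | ∀ v ∈ F, ω (v, k) ∈ T v} =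
      ∏ v ∈ F, (volume : Measure unitInterval).real (T v) := by
  classical
  have : {ω : V × ℕ → unitInterval | ∀ v ∈ F, ω (v, k) ∈ T v} =
      Set.pi (F.image fun v => (v, k) : Finset (V × ℕ)) fun i => T i.1 := by
    ext ω
    simp [Set.mem_pi]
  rw [this, Measure.real, tapeMeasure, Measure.infinitePi_pi _ fun i _ => hT i.1,
    Finset.prod_image fun _ _ _ _ h => (Prod.ext_iff.1 h).1, ENNReal.toReal_prod]
  rfl

/-- Only an inequality, because `q` may exceed `1`. -/
theorem volume_real_lt_le {q : ℝ} (hq : 0 ≤ q) :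
    (volume : Measure unitInterval).real {x | (x : ℝ) < q} ≤ q := by
  refine ENNReal.toReal_le_of_le_ofReal hq ?_
  rw [unitInterval.volume_apply]
  refine (measure_mono (t := Set.Ico 0 q) ?_).trans (by simp)
  rintro _ ⟨x, hx, rfl⟩
  exact ⟨x.2.1, hx⟩

theorem volume_real_le_le (q : ℝ) :
    (volume : Measure unitInterval).real {x | q ≤ (x : ℝ)} ≤ Real.exp (-q) := by
  refine ENNReal.toReal_le_of_le_ofReal (Real.exp_pos _).le ?_
  rw [unitInterval.volume_apply]
  refine (measure_mono (t := Set.Icc q 1) ?_).trans ?_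
  · rintro _ ⟨x, hx, rfl⟩
    exact ⟨hx, x.2.2⟩
  · rw [Real.volume_Icc]
    exact ENNReal.ofReal_le_ofReal (by linarith [Real.add_one_le_exp (-q)])

/-- The events in question factor through variables with countably many values, such as the sample,
the ranks and the set of remaining nodes. Their measurability follows without looking at the
combinatorial functions applied to these. -/
theorem measurableSet_of_countable_range {Ω δ : Type*} [MeasurableSpace Ω] [Countable δ]
    {f : Ω → δ} (hf : ∀ d, MeasurableSet {ω | f ω = d}) (p : δ → Prop) :
    MeasurableSet {ω | p (f ω)} := by
  have : {ω | p (f ω)} = ⋃ d ∈ {d | p d}, {ω | f ω = d} := by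
    ext ω
    simp
  rw [this]
  exact MeasurableSet.biUnion (Set.to_countable _) fun d _ => hf d

theorem measureReal_eq_sum_inter {Ω δ : Type*} [MeasurableSpace Ω] [Fintype δ] (μ : Measure Ω)
    [IsFiniteMeasure μ] {f : Ω → δ} (hf : ∀ d, MeasurableSet {ω | f ω = d}) {s : Set Ω}
    (hs : MeasurableSet s) : μ.real s = ∑ d, μ.real ({ω | f ω = d} ∩ s) := by
  rw [← measureReal_biUnion_finset]
  · congr 1
    ext ω
    simp
  · intro d _ d' _ hne
    refine Set.disjoint_left.2 fun ω h h' => hne ?_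
    exact (h.1 : f ω = d).symm.trans h'.1
  · exact fun d _ => (hf d).inter hs

end Tapes

/-! ### The size of the sample and the degrees of the leftover nodes -/

namespace KT2MIS

section Probability

open scoped Classical

variable {V : Type*} [Fintype V] {N : ℕ} {c : ℝ} {W : Network V N}

theorem measurableSet_sampled_rank (B : Set V × (V → ℕ)) :
    MeasurableSet {ω : V × ℕ → unitInterval | (sampledSet c ω, rank ω 1) = B} := by
  have : {ω : V × ℕ → unitInterval | (sampledSet c ω, rank ω 1) = B} =
      ⋂ v, ({ω | (ω (v, 0) : ℝ) < c / Real.sqrt (Fintype.card V)} ∩ {_ω | v ∈ B.1} ∪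
        {ω | (ω (v, 0) : ℝ) < c / Real.sqrt (Fintype.card V)}ᶜ ∩ {_ω | v ∉ B.1}) ∩
        {ω | rank ω 1 v = B.2 v} := by
    ext ω
    rw [Set.mem_ofPred_eq, Prod.ext_iff, Set.ext_iff, funext_iff, ← forall_and, Set.mem_iInter]
    refine forall_congr' fun v => and_congr_left fun _ => ?_
    exact iff_iff_and_or_not_and_not (a := v ∈ sampledSet c ω) (b := v ∈ B.1)
  rw [this]
  refine MeasurableSet.iInter fun v => ?_
  have h1 : MeasurableSet {ω : V × ℕ → unitInterval |
      (ω (v, 0) : ℝ) < c / Real.sqrt (Fintype.card V)} :=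
    measurableSet_lt (by fun_prop) measurable_const
  have h2 : Measurable fun ω : V × ℕ → unitInterval => rank ω 1 v :=
    Nat.measurable_floor.comp (by fun_prop)
  exact ((h1.inter (.const _)).union (h1.compl.inter (.const _))).inter
    (h2 (measurableSet_singleton _))

theorem measurableSet_rank_eq (k : ℕ) (r : V → ℕ) :
    MeasurableSet {ω : V × ℕ → unitInterval | rank ω k = r} := by
  have : Measurable fun ω : V × ℕ → unitInterval => rank ω k :=
    measurable_pi_iff.2 fun v => Nat.measurable_floor.comp (by fun_prop)
  exact this (measurableSet_singleton r)

/-- With probability close to one, few nodes are sampled. -/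
theorem tapeMeasure_real_le_ncard_sampledSet_le (hc : 0 < c) (k : ℕ) :
    (tapeMeasure V).real {ω | k ≤ (sampledSet c ω).ncard} ≤
      (Fintype.card V * (c / Real.sqrt (Fintype.card V))) ^ k / k.factorial := by
  set q := c / Real.sqrt (Fintype.card V) with hq
  have hq0 : 0 ≤ q := by positivity
  -- Union bound over the `k`-subsets that could be sampled entirely.
  have hsub : {ω : V × ℕ → unitInterval | k ≤ (sampledSet c ω).ncard} ⊆
      ⋃ T ∈ (Finset.univ : Finset V).powersetCard k,
        {ω | ∀ v ∈ T, ω (v, 0) ∈ {x : unitInterval | (x : ℝ) < q}} := by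
    intro ω hω
    rw [Set.mem_ofPred_eq, Set.ncard_eq_toFinset_card'] at hω
    obtain ⟨T, hT, hTk⟩ := Finset.exists_subset_card_eq hω
    refine Set.mem_biUnion (Finset.mem_powersetCard.2 ⟨Finset.subset_univ T, hTk⟩) fun v hv => ?_
    have hv' : v ∈ sampledSet c ω := Set.mem_toFinset.1 (hT hv)
    exact hv'
  refine (measureReal_mono hsub (measure_ne_top _ _)).trans ((measureReal_biUnion_finset_le _ _).trans ?_)
  calc _ ≤ ∑ T ∈ (Finset.univ : Finset V).powersetCard k, q ^ k := by
        refine Finset.sum_le_sum fun T hT => ?_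
        rw [tapeMeasure_real_forall_mem 0 T fun _ => measurableSet_lt (by fun_prop) (by fun_prop),
          ← (Finset.mem_powersetCard.1 hT).2, ← Finset.prod_const]
        exact Finset.prod_le_prod (fun _ _ => measureReal_nonneg) fun _ _ => volume_real_lt_le hq0
    _ = (Fintype.card V).choose k * q ^ k := by
        rw [Finset.sum_const, Finset.card_powersetCard, nsmul_eq_mul, Finset.card_univ]
    _ ≤ (Fintype.card V : ℝ) ^ k / k.factorial * q ^ k := by
        gcongr
        exact Nat.choose_le_pow_div k _
    _ = _ := by rw [mul_pow]; ring

variable (c W) in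
/-- The nodes that are left over by the sequential greedy algorithm on the sampled nodes. -/
def leftover (ω : V × ℕ → unitInterval) : Set V :=
  undominated W.graph (greedyMIS W.graph (W.key (rank ω 1)) (sampledSet c ω))

/-- With at most `L` sampled nodes the parallel process runs to completion, and the remnant becomes
a function of the sample and the greedy ranks alone. -/
theorem remnant_eq_leftover {ω : V × ℕ → unitInterval}
    (hS : (sampledSet c ω).ncard ≤ stage V) : remnant c W ω = leftover c W ω := by
  ext v
  rw [mem_remnant_iff, leftover, ← greedyProc_eq_greedyMIS (W.key_injective _) hS]
  rfl

theorem rank_congr {ω ω' : V × ℕ → unitInterval} {k : ℕ} (h : ∀ v, ω (v, k) = ω' (v, k)) :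
    rank ω k = rank ω' k := by
  funext v
  rw [rank, rank, h]

/-- With probability close to one, a node that is left over has few neighbours that are. -/
theorem tapeMeasure_real_leftover_le (v : V) (d : ℕ) :
    (tapeMeasure V).real {ω | v ∈ leftover c W ω ∧
        d ≤ {w ∈ leftover c W ω | W.graph.Adj v w}.ncard} ≤
      Real.exp (-(c / Real.sqrt (Fintype.card V) * d)) := by
  set q := c / Real.sqrt (Fintype.card V) with hq
  let U (D : Finset V) (ω : V × ℕ → unitInterval) : Set V :=
    undominated W.graph (greedyMIS W.graph (W.key (rank ω 1)) (sampledSet c ω \ D))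
  -- Greedy runs here as if `D` were not sampled, so `F D` is independent of the event `B D` that
  -- `D` indeed is not. On `B D` the two runs coincide.
  let F (D : Finset V) : Set (V × ℕ → unitInterval) :=
    {ω | v ∈ U D ω ∧ {w | W.graph.Adj v w ∧ w ∈ U D ω} = D}
  let B (D : Finset V) : Set (V × ℕ → unitInterval) :=
    {ω | ∀ w ∈ D, ω (w, 0) ∈ {x : unitInterval | q ≤ (x : ℝ)}}
  have hFm : ∀ D, MeasurableSet (F D) := fun D =>
    measurableSet_of_countable_range (measurableSet_sampled_rank (c := c)) fun b =>
      v ∈ undominated W.graph (greedyMIS W.graph (W.key b.2) (b.1 \ D)) ∧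
      {w | W.graph.Adj v w ∧ w ∈ undominated W.graph
        (greedyMIS W.graph (W.key b.2) (b.1 \ D))} = D
  have hBm : ∀ D, MeasurableSet (B D) := fun D => by
    have : B D = ⋂ w ∈ D, {ω | q ≤ (ω (w, 0) : ℝ)} := by
      ext ω
      simp [B]
    rw [this]
    exact Finset.measurableSet_biInter _ fun w _ =>
      measurableSet_le measurable_const (by fun_prop)
  have hdisj : Pairwise fun D D' => Disjoint (F D) (F D') := fun D D' hne =>
    Set.disjoint_left.2 fun ω h h' => hne <| Finset.coe_injective <|
      undominated_neighbors_unique h.1 h'.1 h.2 h'.2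
  have hsub : {ω | v ∈ leftover c W ω ∧ d ≤ {w ∈ leftover c W ω | W.graph.Adj v w}.ncard} ⊆
      ⋃ D ∈ (Finset.univ : Finset (Finset V)).filter fun D => d ≤ D.card, F D ∩ B D := by
    rintro ω ⟨hv, hd⟩
    set D := {w ∈ leftover c W ω | W.graph.Adj v w}.toFinset with hD
    have hDmem : ∀ w, w ∈ D ↔ w ∈ leftover c W ω ∧ W.graph.Adj v w := fun w => by simp [hD]
    have hns : ∀ w ∈ D, w ∉ sampledSet c ω := fun w hw =>
      disjoint_undominated_greedyMIS ((hDmem w).1 hw).1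
    have hSD : sampledSet c ω \ D = sampledSet c ω :=
      sdiff_eq_left.2 (Set.disjoint_left.2 fun w hs hw => hns w hw hs)
    rw [Set.ncard_eq_toFinset_card'] at hd
    refine Set.mem_biUnion (x := D) (Finset.mem_filter.2 ⟨Finset.mem_univ _, hd⟩) ⟨⟨?_, ?_⟩, ?_⟩
    · simp only [U, hSD]
      exact hv
    · simp only [U, hSD]
      ext w
      rw [Finset.mem_coe, hDmem, and_comm]
      rfl
    · intro w hw
      have hlt : ¬ (ω (w, 0) : ℝ) < q := hns w hw
      exact not_lt.1 hlt
  refine (measureReal_mono hsub (measure_ne_top _ _)).trans ((measureReal_biUnion_finset_le _ _).trans ?_)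
  have hterm : ∀ D ∈ (Finset.univ : Finset (Finset V)).filter (fun D => d ≤ D.card),
      (tapeMeasure V).real (F D ∩ B D) ≤ (tapeMeasure V).real (F D) * Real.exp (-(q * d)) := by
    intro D hD
    have hJ : DependsOn (fun ω => ω ∈ B D) ((D ×ˢ {0} : Finset (V × ℕ)) : Set (V × ℕ)) :=
      fun ω ω' h => by
        refine propext (forall₂_congr fun w hw => ?_)
        rw [h (w, 0) (by simpa using hw)]
    have hI : DependsOn (fun ω => ω ∈ F D)
        ((Finset.univ ×ˢ {1} ∪ Dᶜ ×ˢ {0} : Finset (V × ℕ)) : Set (V × ℕ)) := fun ω ω' h => by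
      have h1 : rank ω 1 = rank ω' 1 := rank_congr fun w => h (w, 1) (by simp)
      have h2 : sampledSet c ω \ D = sampledSet c ω' \ D := by
        ext w
        refine and_congr_left fun hw => ?_
        have hw' : w ∉ D := hw
        rw [sampledSet, sampledSet, Set.mem_ofPred_eq, Set.mem_ofPred_eq, h (w, 0) (by simp [hw'])]
      simp only [F, U, Set.mem_ofPred_eq, h1, h2]
    rw [tapeMeasure_real_inter_of_dependsOn ?_ (hFm D) (hBm D) hI hJ]
    · refine mul_le_mul_of_nonneg_left ?_ measureReal_nonneg
      rw [tapeMeasure_real_forall_mem 0 D fun _ => measurableSet_le (by fun_prop) (by fun_prop)]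
      -- The sign of `c` is not assumed; for negative `q` the bound is at least `1`.
      by_cases hq0 : 0 ≤ q
      · calc _ ≤ ∏ _w ∈ D, Real.exp (-q) :=
              Finset.prod_le_prod (fun _ _ => measureReal_nonneg) fun _ _ => volume_real_le_le q
          _ = Real.exp (-(q * D.card)) := by
              rw [Finset.prod_const, ← Real.exp_nat_mul]
              ring_nf
          _ ≤ _ := by
              gcongr
              exact (Finset.mem_filter.1 hD).2
      · refine (Finset.prod_le_one (fun _ _ => measureReal_nonneg)
          fun _ _ => measureReal_le_one).trans (Real.one_le_exp ?_)
        nlinarith [not_le.1 hq0, Nat.cast_nonneg (α := ℝ) d]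
    · refine Finset.disjoint_left.2 fun i hi hi' => ?_
      simp only [Finset.mem_union, Finset.mem_product, Finset.mem_singleton,
        Finset.mem_compl] at hi hi'
      rcases hi with h | h
      · exact absurd (h.2.symm.trans hi'.2) one_ne_zero
      · exact h.1 hi'.1
  refine (Finset.sum_le_sum hterm).trans ?_
  -- Disjointness replaces a union bound over the exponentially many sets `D`: the probabilities of
  -- the events `F D` add up to at most `1`.
  rw [← Finset.sum_mul, ← measureReal_biUnion_finset (fun D _ D' _ h => hdisj h) fun D _ => hFm D]
  exact mul_le_of_le_one_left (Real.exp_pos _).le measureReal_le_one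

end Probability

end KT2MIS

/-! ### The progress of Luby's algorithm -/

namespace KT2MIS

section LubyProgress

open scoped Classical

variable {V : Type*} [Fintype V] {N : ℕ} {c : ℝ} {W : Network V N}

variable (W) in
/-- The ordered pairs of adjacent nodes in `A`. -/
noncomputable def darts (A : Set V) : Finset (V × V) :=
  Finset.univ.filter fun p => p.1 ∈ A ∧ p.2 ∈ A ∧ W.graph.Adj p.1 p.2

variable (W) in
/-- The neighbours of `v` in `A`. -/
noncomputable def nbrs (A : Set V) (v : V) : Finset V :=
  Finset.univ.filter fun u => u ∈ A ∧ W.graph.Adj v u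

theorem mem_darts {A : Set V} {p : V × V} :
    p ∈ darts W A ↔ p.1 ∈ A ∧ p.2 ∈ A ∧ W.graph.Adj p.1 p.2 := by simp [darts]

theorem mem_nbrs {A : Set V} {v u : V} : u ∈ nbrs W A v ↔ u ∈ A ∧ W.graph.Adj v u := by
  simp [nbrs]

theorem sum_darts (A : Set V) (f : V → V → ℝ) :
    ∑ p ∈ darts W A, f p.1 p.2 = ∑ v ∈ A.toFinset, ∑ u ∈ nbrs W A v, f v u :=
  Finset.sum_finset_product' _ _ _ fun p => by simp [mem_darts, mem_nbrs]

theorem sum_darts_swap (A : Set V) (f : V → V → ℝ) :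
    ∑ p ∈ darts W A, f p.1 p.2 = ∑ p ∈ darts W A, f p.2 p.1 := by
  refine Finset.sum_equiv (Equiv.prodComm V V) (fun p => ?_) fun p _ => rfl
  simp only [mem_darts, Equiv.prodComm_apply, Prod.fst_swap, Prod.snd_swap,
    W.graph.adj_comm p.2 p.1]
  tauto

/-- `x` has rank at least `(R - R / (2 * m)) / R`, where `R` is the number of ranks. -/
noncomputable def rankThreshold (R m : ℕ) : unitInterval :=
  ⟨((R - R / (2 * m) : ℕ) : ℝ) / R, by positivity,
    div_le_one_of_le₀ (by exact_mod_cast Nat.sub_le _ _) (Nat.cast_nonneg _)⟩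

/-- The threshold is a multiple of `1 / R`, so rounding a tape entry down to a rank never crosses
it. Entries on different sides give strictly ordered ranks, and tie-breaking plays no role. -/
theorem le_rank_of_rankThreshold_le {ω : V × ℕ → unitInterval} {k m : ℕ} {v : V}
    (h : rankThreshold (Fintype.card V ^ 4) m ≤ ω (v, k)) :
    Fintype.card V ^ 4 - Fintype.card V ^ 4 / (2 * m) ≤ rank ω k v := by
  have hpos : (0 : ℝ) < (Fintype.card V : ℝ) ^ 4 := by
    have := Fintype.card_pos_iff.2 ⟨v⟩
    positivity
  refine Nat.le_floor ?_
  have h' : (((Fintype.card V ^ 4 - Fintype.card V ^ 4 / (2 * m) : ℕ) : ℝ)) /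
    ((Fintype.card V ^ 4 : ℕ) : ℝ) ≤ ω (v, k) := h
  rwa [Nat.cast_pow, div_le_iff₀ hpos] at h'

theorem rank_lt_of_lt_rankThreshold {ω : V × ℕ → unitInterval} {k m : ℕ} {v : V}
    (h : ω (v, k) < rankThreshold (Fintype.card V ^ 4) m) :
    rank ω k v < Fintype.card V ^ 4 - Fintype.card V ^ 4 / (2 * m) := by
  have hpos : (0 : ℝ) < (Fintype.card V : ℝ) ^ 4 := by
    have := Fintype.card_pos_iff.2 ⟨v⟩
    positivity
  have h' : (ω (v, k) : ℝ) < (((Fintype.card V ^ 4 - Fintype.card V ^ 4 / (2 * m) : ℕ) : ℝ)) /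
    ((Fintype.card V ^ 4 : ℕ) : ℝ) := h
  rw [Nat.cast_pow, lt_div_iff₀ hpos] at h'
  exact (Nat.floor_lt (mul_nonneg (ω (v, k)).2.1 hpos.le)).2 h'

/-- The quotient `R / (2 * m)` is at least `1`, so rounding down at most halves it; hence `4 * m` in
the second bound. -/
theorem rankThreshold_bounds {R m : ℕ} (hm : 0 < m) (hR : 2 * m ≤ R) :
    1 - 1 / (2 * m : ℝ) ≤ rankThreshold R m ∧ 1 / (4 * m : ℝ) ≤ 1 - rankThreshold R m := by
  have hR0 : (0 : ℝ) < R := by exact_mod_cast (by omega : 0 < R)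
  have hm0 : (0 : ℝ) < m := by exact_mod_cast hm
  have hval : (rankThreshold R m : ℝ) = 1 - ((R / (2 * m) : ℕ) : ℝ) / R := by
    change ((R - R / (2 * m) : ℕ) : ℝ) / R = _
    rw [Nat.cast_sub (Nat.div_le_self _ _), sub_div, div_self hR0.ne']
  have hq1 : 1 ≤ R / (2 * m) := (Nat.one_le_div_iff (by omega)).2 hR
  have hq2 : R / (2 * m) * (2 * m) ≤ R := Nat.div_mul_le_self _ _
  have hq3 : R < (R / (2 * m) + 1) * (2 * m) := by
    rw [mul_comm]
    exact Nat.lt_mul_div_succ R (by omega)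
  rw [hval]
  generalize R / (2 * m) = q at *
  have hq1' : (1 : ℝ) ≤ q := by exact_mod_cast hq1
  have hq2' : (q : ℝ) * (2 * m) ≤ R := by exact_mod_cast hq2
  have hq3' : (R : ℝ) < (q + 1) * (2 * m) := by exact_mod_cast hq3
  constructor
  · rw [sub_le_sub_iff_left, div_le_div_iff₀ hR0 (by positivity)]
    linarith
  · rw [sub_sub_cancel, div_le_div_iff₀ (by positivity) hR0]
    nlinarith

variable (W) in
/-- An event at which `u` wins a phase on `A`, and no other neighbour of `v` wins. -/
def eliminates (A : Set V) (k : ℕ) (u v : V) : Set (V × ℕ → unitInterval) :=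
  let m := (nbrs W A u).card + (nbrs W A v).card
  {ω | ∀ w ∈ insert u (nbrs W A u ∪ nbrs W A v), ω (w, k) ∈
    if w = u then Set.Ici (rankThreshold (Fintype.card V ^ 4) m)
    else Set.Iio (rankThreshold (Fintype.card V ^ 4) m)}

theorem measurableSet_eliminates (A : Set V) (k : ℕ) (u v : V) :
    MeasurableSet (eliminates W A k u v) := by
  have : eliminates W A k u v = ⋂ w ∈ insert u (nbrs W A u ∪ nbrs W A v),
      (fun ω : V × ℕ → unitInterval => ω (w, k)) ⁻¹' (if w = u then
        Set.Ici (rankThreshold (Fintype.card V ^ 4) ((nbrs W A u).card + (nbrs W A v).card))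
      else Set.Iio
        (rankThreshold (Fintype.card V ^ 4) ((nbrs W A u).card + (nbrs W A v).card))) := by
    ext ω
    simp [eliminates]
  rw [this]
  refine Finset.measurableSet_biInter _ fun w _ => measurable_pi_apply _ ?_
  split_ifs
  · exact measurableSet_Ici
  · exact measurableSet_Iio

theorem rank_lt_rank_of_mem_eliminates {A : Set V} {k : ℕ} {u v w : V}
    {ω : V × ℕ → unitInterval} (hω : ω ∈ eliminates W A k u v) (hne : w ≠ u)
    (hw : w ∈ nbrs W A u ∪ nbrs W A v) : rank ω k w < rank ω k u := by
  have h1 := hω w (Finset.mem_insert_of_mem hw)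
  have h2 := hω u (Finset.mem_insert_self _ _)
  rw [if_neg hne] at h1
  rw [if_pos rfl] at h2
  exact (rank_lt_of_lt_rankThreshold h1).trans_le (le_rank_of_rankThreshold_le h2)

theorem eliminates_subset {A : Set V} {k : ℕ} {u v : V} (hu : u ∈ nbrs W A v) :
    eliminates W A k u v ⊆ {ω | v ∈ lubyStep W.graph (W.key (rank ω k)) A}ᶜ := by
  intro ω hω hv
  refine hv.2.2 u (mem_nbrs.1 hu).2 ⟨(mem_nbrs.1 hu).1, fun w hw hwA => ?_⟩
  refine Prod.Lex.toLex_lt_toLex.2 (.inl ?_)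
  exact rank_lt_rank_of_mem_eliminates hω hw.ne'
    (Finset.mem_union_left _ (mem_nbrs.2 ⟨hwA, hw⟩))

/-- Each event ranks its own winner above every other neighbour of `v`. The probabilities of
removing `v` can therefore be added over its neighbours `u`. -/
theorem disjoint_eliminates {A : Set V} {k : ℕ} {u u' v : V} (hu : u ∈ nbrs W A v)
    (hu' : u' ∈ nbrs W A v) (hne : u ≠ u') :
    Disjoint (eliminates W A k u v) (eliminates W A k u' v) :=
  Set.disjoint_left.2 fun _ h h' => lt_asymm
    (rank_lt_rank_of_mem_eliminates h hne.symm (Finset.mem_union_right _ hu'))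
    (rank_lt_rank_of_mem_eliminates h' hne (Finset.mem_union_right _ hu))

/-- With `m` the sum of the two degrees, `u` reaches the threshold with probability at least `1 / (4
m)`. The at most `m` other nodes all stay below it with probability at least `(1 - 1 / (2 m)) ^ m ≥
1 / 2`, by Bernoulli's inequality. -/
theorem le_tapeMeasure_real_eliminates {A : Set V} (k : ℕ) {u v : V} (hv : v ∈ A)
    (hu : u ∈ nbrs W A v) :
    1 / (8 * ((nbrs W A u).card + (nbrs W A v).card)) ≤
      (tapeMeasure V).real (eliminates W A k u v) := by
  set m := (nbrs W A u).card + (nbrs W A v).card with hm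
  have hvu : v ∈ nbrs W A u := mem_nbrs.2 ⟨hv, (mem_nbrs.1 hu).2.symm⟩
  have hu1 : 0 < (nbrs W A u).card := Finset.card_pos.2 ⟨v, hvu⟩
  have hm0 : 0 < m := by omega
  have hcard : 2 ≤ Fintype.card V := Fintype.one_lt_card_iff.2 ⟨v, u, (mem_nbrs.1 hu).2.ne⟩
  have hR : 2 * m ≤ Fintype.card V ^ 4 := by
    have h1 : m ≤ 2 * Fintype.card V := by
      have := Finset.card_le_univ (nbrs W A u)
      have := Finset.card_le_univ (nbrs W A v)
      omega
    have h2 : 2 ^ 3 ≤ Fintype.card V ^ 3 := Nat.pow_le_pow_left hcard 3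
    have h3 : Fintype.card V ^ 4 = Fintype.card V ^ 3 * Fintype.card V := pow_succ _ 3
    nlinarith
  obtain ⟨hθ1, hθ2⟩ := rankThreshold_bounds hm0 hR
  set θ := rankThreshold (Fintype.card V ^ 4) m
  have hm0' : (1 : ℝ) ≤ m := by exact_mod_cast hm0
  have hne : ∀ w ∈ (nbrs W A u ∪ nbrs W A v).erase u, w ≠ u := fun w hw => Finset.ne_of_mem_erase hw
  rw [eliminates, tapeMeasure_real_forall_mem k _ fun w => ?_]
  swap
  · split_ifs
    · exact measurableSet_Ici
    · exact measurableSet_Iio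
  rw [← Finset.insert_erase (Finset.mem_insert_self u _), Finset.erase_insert_eq_erase,
    Finset.prod_insert (Finset.notMem_erase _ _), if_pos rfl,
    Finset.prod_congr rfl fun w hw => by rw [if_neg (hne w hw)], Finset.prod_const]
  have e1 : (volume : Measure unitInterval).real (Set.Ici θ) = 1 - θ := by
    rw [Measure.real, unitInterval.volume_Ici, ENNReal.toReal_ofReal (sub_nonneg.2 θ.2.2)]
  have e2 : (volume : Measure unitInterval).real (Set.Iio θ) = θ := by
    rw [Measure.real, unitInterval.volume_Iio, ENNReal.toReal_ofReal θ.2.1]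
  rw [← hm, e1, e2]
  have hcard' : ((nbrs W A u ∪ nbrs W A v).erase u).card ≤ m :=
    (Finset.card_erase_le).trans (Finset.card_union_le _ _)
  have hb : (1 / 2 : ℝ) ≤ (θ : ℝ) ^ ((nbrs W A u ∪ nbrs W A v).erase u).card := by
    refine le_trans ?_ (pow_le_pow_of_le_one θ.2.1 θ.2.2 hcard')
    have hinv : 1 / (2 * m : ℝ) ≤ 1 / 2 := by
      rw [div_le_div_iff₀ (by positivity) (by norm_num)]
      linarith
    refine le_trans ?_ (pow_le_pow_left₀ (by linarith) hθ1 m)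
    have := one_add_mul_le_pow (a := -(1 / (2 * m : ℝ))) (by linarith) m
    rw [← sub_eq_add_neg] at this
    refine le_trans (le_of_eq ?_) this
    field_simp
    norm_num
  calc (1 : ℝ) / (8 * ((nbrs W A u).card + (nbrs W A v).card)) = 1 / (4 * m) * (1 / 2) := by
        rw [hm]
        push_cast
        field_simp
        norm_num
    _ ≤ _ := mul_le_mul hθ2 hb (by norm_num) (sub_nonneg.2 θ.2.2)

theorem measurableSet_lubyStep (A : Set V) (k : ℕ) (p : Set V → Prop) :
    MeasurableSet {ω : V × ℕ → unitInterval | p (lubyStep W.graph (W.key (rank ω k)) A)} :=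
  measurableSet_of_countable_range (measurableSet_rank_eq k) fun r =>
    p (lubyStep W.graph (W.key r) A)

/-- In expectation, a phase removes a constant fraction of the edges. -/
theorem sum_tapeMeasure_real_mem_darts_lubyStep_le (A : Set V) (k : ℕ) :
    ∑ p : V × V, (tapeMeasure V).real {ω | p ∈ darts W (lubyStep W.graph (W.key (rank ω k)) A)} ≤
      15 / 16 * (darts W A).card := by
  set d : V → ℝ := fun v => (nbrs W A v).card
  have hstep : ∀ v ∈ A, (tapeMeasure V).real
      {ω | v ∈ lubyStep W.graph (W.key (rank ω k)) A} ≤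
      1 - ∑ u ∈ nbrs W A v, 1 / (8 * (d u + d v)) := by
    intro v hv
    have hm := measurableSet_lubyStep (W := W) A k fun B => v ∈ B
    have h1 : ∑ u ∈ nbrs W A v, 1 / (8 * (d u + d v)) ≤ (tapeMeasure V).real
        {ω | v ∈ lubyStep W.graph (W.key (rank ω k)) A}ᶜ := by
      refine (Finset.sum_le_sum fun u hu => le_tapeMeasure_real_eliminates k hv hu).trans ?_
      rw [← measureReal_biUnion_finset
        (fun u hu u' hu' hne => disjoint_eliminates (Finset.mem_coe.1 hu) (Finset.mem_coe.1 hu') hne)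
        fun u _ => measurableSet_eliminates A k u v]
      exact measureReal_mono (Set.iUnion₂_subset fun u hu => eliminates_subset hu)
    rw [measureReal_compl hm, probReal_univ] at h1
    linarith
  -- A dart survives only if its first end does; ignoring the second end is affordable.
  have hle : ∀ p : V × V, (tapeMeasure V).real
      {ω | p ∈ darts W (lubyStep W.graph (W.key (rank ω k)) A)} ≤
      if p ∈ darts W A then 1 - ∑ u ∈ nbrs W A p.1, 1 / (8 * (d u + d p.1)) else 0 := by
    intro p
    split_ifs with hp
    · refine (measureReal_mono fun ω hω => ?_).trans (hstep p.1 (mem_darts.1 hp).1)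
      exact (mem_darts.1 hω).1
    · refine (measureReal_mono (s₂ := ∅) fun ω hω => hp ?_).trans (by simp)
      obtain ⟨h1, h2, h3⟩ := mem_darts.1 hω
      exact mem_darts.2 ⟨h1.1, h2.1, h3⟩
  refine (Finset.sum_le_sum fun p _ => hle p).trans ?_
  rw [Finset.sum_ite_mem, Finset.univ_inter, Finset.sum_sub_distrib, Finset.sum_const,
    nsmul_one]
  have hX : ∑ p ∈ darts W A, ∑ u ∈ nbrs W A p.1, 1 / (8 * (d u + d p.1)) =
      ∑ p ∈ darts W A, d p.1 / (8 * (d p.1 + d p.2)) := by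
    rw [sum_darts A fun v _ => ∑ u ∈ nbrs W A v, 1 / (8 * (d u + d v)),
      sum_darts A fun v u => d v / (8 * (d v + d u))]
    refine Finset.sum_congr rfl fun v _ => ?_
    rw [Finset.sum_const, nsmul_eq_mul, Finset.mul_sum]
    refine Finset.sum_congr rfl fun u _ => ?_
    rw [mul_one_div, add_comm (d u)]
  -- Reversing the darts turns the weight `d v / (8 (d v + d u))` into its complement to `1 / 8`.
  -- The expected loss is thus half of `1 / 8` per dart.
  have hY := sum_darts_swap (W := W) A fun v u => d v / (8 * (d v + d u))
  have hZ : ∑ p ∈ darts W A, d p.1 / (8 * (d p.1 + d p.2)) +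
      ∑ p ∈ darts W A, d p.2 / (8 * (d p.2 + d p.1)) = (darts W A).card * (1 / 8) := by
    rw [← Finset.sum_add_distrib, ← nsmul_eq_mul, ← Finset.sum_const]
    refine Finset.sum_congr rfl fun p hp => ?_
    obtain ⟨h1, h2, h3⟩ := mem_darts.1 hp
    have hd : 0 < d p.1 := Nat.cast_pos.2 (Finset.card_pos.2 ⟨p.2, mem_nbrs.2 ⟨h2, h3⟩⟩)
    have hd' : 0 ≤ d p.2 := Nat.cast_nonneg _
    rw [add_comm (d p.2)]
    field_simp
  rw [hX]
  linarith

variable (c W) in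
/-- The nodes that remain after `j` phases of Luby's algorithm on the left-over nodes. -/
noncomputable def lubyLeftover (j : ℕ) (ω : V × ℕ → unitInterval) : Set V :=
  lubySet W ω (leftover c W ω) j

theorem measurableSet_lubyLeftover (j : ℕ) (A : Set V) :
    MeasurableSet {ω | lubyLeftover c W j ω = A} := by
  induction j generalizing A with
  | zero =>
    exact measurableSet_of_countable_range (measurableSet_sampled_rank (c := c)) fun b =>
      undominated W.graph (greedyMIS W.graph (W.key b.2) b.1) = A
  | succ j ih =>
    refine measurableSet_of_countable_range
      (f := fun ω : V × ℕ → unitInterval => (lubyLeftover c W j ω, rank ω (j + 2)))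
      (fun b => ?_) fun b => lubyStep W.graph (W.key b.2) b.1 = A
    simp only [Prod.ext_iff]
    exact (ih b.1).inter (measurableSet_rank_eq (j + 2) b.2)

theorem dependsOn_lubyLeftover (j : ℕ) : DependsOn (lubyLeftover c W j)
    ((Finset.univ ×ˢ Finset.range (j + 2) : Finset (V × ℕ)) : Set (V × ℕ)) := by
  induction j with
  | zero =>
    intro ω ω' h
    have h1 : rank ω 1 = rank ω' 1 := rank_congr fun w => h (w, 1) (by simp)
    have h2 : sampledSet c ω = sampledSet c ω' := by
      ext w
      rw [sampledSet, sampledSet, Set.mem_ofPred_eq, Set.mem_ofPred_eq, h (w, 0) (by simp)]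
    change leftover c W ω = leftover c W ω'
    rw [leftover, leftover, h1, h2]
  | succ j ih =>
    intro ω ω' h
    have h1 : rank ω (j + 2) = rank ω' (j + 2) := rank_congr fun w => h (w, j + 2) (by simp)
    have h2 : lubyLeftover c W j ω = lubyLeftover c W j ω' := ih fun i hi => h i (by
      simp only [Finset.coe_product, Finset.coe_univ, Finset.coe_range, Set.mem_prod,
        Set.mem_univ, Set.mem_Iio, true_and] at hi ⊢
      omega)
    change lubyStep W.graph (W.key (rank ω (j + 2))) (lubyLeftover c W j ω) =
      lubyStep W.graph (W.key (rank ω' (j + 2))) (lubyLeftover c W j ω')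
    rw [h1, h2]

variable (c W) in
/-- The expected number of ordered pairs of adjacent nodes after `j` phases. -/
noncomputable def expectedDarts (j : ℕ) : ℝ :=
  ∑ p : V × V, (tapeMeasure V).real {ω | p ∈ darts W (lubyLeftover c W j ω)}

theorem expectedDarts_eq (j : ℕ) : expectedDarts c W j =
    ∑ A : Set V, (tapeMeasure V).real {ω | lubyLeftover c W j ω = A} * (darts W A).card := by
  have h1 : ∀ p : V × V, (tapeMeasure V).real {ω | p ∈ darts W (lubyLeftover c W j ω)} =
      ∑ A : Set V, (tapeMeasure V).real {ω | lubyLeftover c W j ω = A} *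
        if p ∈ darts W A then 1 else 0 := by
    intro p
    rw [measureReal_eq_sum_inter _ (measurableSet_lubyLeftover (c := c) (W := W) j)
      (measurableSet_of_countable_range (measurableSet_lubyLeftover (c := c) (W := W) j)
        fun A => p ∈ darts W A)]
    refine Finset.sum_congr rfl fun A _ => ?_
    split_ifs with hp
    · rw [mul_one]
      congr 1
      ext ω
      refine and_iff_left_of_imp fun h => ?_
      rw [Set.mem_ofPred_eq] at h ⊢
      rwa [h]
    · rw [mul_zero]
      refine (congrArg _ (Set.eq_empty_of_forall_notMem fun ω hω => hp ?_)).trans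
        measureReal_empty
      obtain ⟨h, h'⟩ := hω
      rw [Set.mem_ofPred_eq] at h h'
      rwa [h] at h'
  simp only [expectedDarts, h1]
  rw [Finset.sum_comm]
  refine Finset.sum_congr rfl fun A _ => ?_
  rw [← Finset.mul_sum, Finset.sum_boole]
  simp

/-- Condition on the set `A` left after `j` phases: it depends only on the tape entries with index
below `j + 2`, while the next phase uses the entries with index `j + 2`. So the one-phase estimate
applies to each fixed `A`. -/
theorem expectedDarts_succ_le (j : ℕ) :
    expectedDarts c W (j + 1) ≤ 15 / 16 * expectedDarts c W j := by
  have h1 : ∀ p : V × V, (tapeMeasure V).real {ω | p ∈ darts W (lubyLeftover c W (j + 1) ω)} =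
      ∑ A : Set V, (tapeMeasure V).real {ω | lubyLeftover c W j ω = A} *
        (tapeMeasure V).real
          {ω | p ∈ darts W (lubyStep W.graph (W.key (rank ω (j + 2))) A)} := by
    intro p
    rw [measureReal_eq_sum_inter _ (measurableSet_lubyLeftover (c := c) (W := W) j)
      (measurableSet_of_countable_range (measurableSet_lubyLeftover (c := c) (W := W) (j + 1))
        fun A => p ∈ darts W A)]
    refine Finset.sum_congr rfl fun A _ => ?_
    rw [← tapeMeasure_real_inter_of_dependsOn (I := Finset.univ ×ˢ Finset.range (j + 2))
      (J := Finset.univ ×ˢ {j + 2}) ?_ (measurableSet_lubyLeftover j A)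
      (measurableSet_lubyStep A (j + 2) fun B => p ∈ darts W B) ?_ ?_]
    · congr 1
      ext ω
      refine and_congr_right fun h => ?_
      rw [Set.mem_ofPred_eq] at h ⊢
      rw [← h]
      rfl
    · refine Finset.disjoint_left.2 fun i hi hi' => ?_
      simp only [Finset.mem_product, Finset.mem_range, Finset.mem_singleton] at hi hi'
      omega
    · intro ω ω' h
      simp only [Set.mem_ofPred_eq, dependsOn_lubyLeftover j h]
    · intro ω ω' h
      have : rank ω (j + 2) = rank ω' (j + 2) := rank_congr fun w => h (w, j + 2) (by simp)
      simp only [Set.mem_ofPred_eq, this]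
  rw [expectedDarts_eq j, expectedDarts]
  simp only [h1]
  rw [Finset.sum_comm, Finset.mul_sum]
  refine Finset.sum_le_sum fun A _ => ?_
  rw [← Finset.mul_sum, mul_left_comm]
  exact mul_le_mul_of_nonneg_left (sum_tapeMeasure_real_mem_darts_lubyStep_le A (j + 2))
    measureReal_nonneg

theorem expectedDarts_le (j : ℕ) :
    expectedDarts c W j ≤ (15 / 16) ^ j * (Fintype.card V : ℝ) ^ 2 := by
  induction j with
  | zero =>
    refine (Finset.sum_le_card_nsmul _ _ 1 fun p _ => measureReal_le_one).trans ?_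
    simp [sq]
  | succ j ih =>
    refine (expectedDarts_succ_le j).trans ?_
    rw [pow_succ']
    linarith

/-- With probability close to one, Luby's algorithm ends soon. -/
theorem tapeMeasure_real_lubyLeftover_ne_empty_le (j : ℕ) :
    (tapeMeasure V).real {ω | lubyLeftover c W (j + 1) ω ≠ ∅} ≤
      (15 / 16) ^ j * (Fintype.card V : ℝ) ^ 2 := by
  refine le_trans ?_ (expectedDarts_le (c := c) (W := W) j)
  refine (measureReal_mono (s₂ := ⋃ p ∈ (Finset.univ : Finset (V × V)),
    {ω | p ∈ darts W (lubyLeftover c W j ω)}) (fun ω hω => ?_) (measure_ne_top _ _)).trans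
    (measureReal_biUnion_finset_le _ _)
  by_contra h
  -- Once no edge remains, every remaining node wins; this is the extra phase in `j + 1`.
  refine hω (lubyStep_eq_empty fun v hv u hu hvu => h ?_)
  exact Set.mem_biUnion (x := (v, u)) (Finset.mem_univ _) (mem_darts.2 ⟨hv, hu, hvu⟩)

end LubyProgress

end KT2MIS

/-! ### The bounds that hold with high probability -/

namespace KT2MIS

/-! ### Elementary estimates -/

section Numerics

theorem half_le_log {n : ℕ} (hn : 2 ≤ n) : 1 / 2 ≤ Real.log n := by
  have h := Real.log_le_log (by norm_num) (show (2 : ℝ) ≤ n by exact_mod_cast hn)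
  linarith [Real.log_two_gt_d9]

theorem one_le_sqrt {n : ℕ} (hn : 2 ≤ n) : 1 ≤ Real.sqrt n :=
  Real.one_le_sqrt.2 (by exact_mod_cast (by omega : 1 ≤ n))

theorem one_le_two_mul_sqrt_mul_log {n : ℕ} (hn : 2 ≤ n) :
    1 ≤ 2 * (Real.sqrt n * Real.log n) := by
  nlinarith [half_le_log hn, one_le_sqrt hn]

theorem stageLength_le {n : ℕ} (hn : 2 ≤ n) :
    (stageLength n : ℝ) ≤ 6 * (Real.sqrt n * Real.log n) := by
  have hl2 := Real.log_two_gt_d9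
  have hl := Real.log_le_log (by norm_num) (show (2 : ℝ) ≤ n by exact_mod_cast hn)
  have h1 : (Nat.sqrt n : ℝ) ≤ Real.sqrt n := Real.nat_sqrt_le_real_sqrt
  have h2 : (Nat.log 2 n : ℝ) * Real.log 2 ≤ Real.log n := by
    rw [← Real.log_pow]
    refine Real.log_le_log (by positivity) ?_
    exact_mod_cast Nat.pow_log_le_self 2 (by omega)
  have h3 : (Nat.log 2 n : ℝ) + 1 ≤ 3 * Real.log n := by
    nlinarith [Nat.cast_nonneg (α := ℝ) (Nat.log 2 n)]
  have h4 : (Nat.sqrt n : ℝ) + 1 ≤ 2 * Real.sqrt n := by linarith [one_le_sqrt hn]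
  unfold stageLength
  push_cast
  calc _ ≤ 2 * Real.sqrt n * (3 * Real.log n) := by gcongr
    _ = _ := by ring

theorem le_stageLength {n : ℕ} (hn : 2 ≤ n) :
    Real.sqrt n * Real.log n ≤ stageLength n := by
  have h1 : Real.sqrt n ≤ Nat.sqrt n + 1 := Real.real_sqrt_le_nat_sqrt_succ
  have h2 : Real.log n ≤ Nat.log 2 n + 1 := by
    have h : (n : ℝ) ≤ 2 ^ (Nat.log 2 n + 1) := by
      exact_mod_cast (Nat.lt_pow_succ_log_self one_lt_two n).le
    have h' := Real.log_le_log (by exact_mod_cast (by omega : 0 < n)) h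
    rw [Real.log_pow] at h'
    push_cast at h'
    nlinarith [Real.log_two_lt_d9, Nat.cast_nonneg (α := ℝ) (Nat.log 2 n)]
  unfold stageLength
  push_cast
  have := half_le_log hn
  gcongr

theorem rpow_three_halves (n : ℕ) : (n : ℝ) ^ (1.5 : ℝ) = n * Real.sqrt n := by
  rw [Real.sqrt_eq_rpow, show (1.5 : ℝ) = 1 + 1 / 2 by norm_num,
    Real.rpow_add_of_nonneg (Nat.cast_nonneg n) (by norm_num) (by norm_num), Real.rpow_one]

theorem rpow_neg_eq_exp {n : ℕ} (hn : 2 ≤ n) (b : ℝ) :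
    (n : ℝ) ^ (-b) = Real.exp (-(b * Real.log n)) := by
  rw [Real.rpow_def_of_pos (by exact_mod_cast (by omega : 0 < n))]
  ring_nf

/-- From `k ^ k / k! ≤ e ^ k` the left side is at most `(e / 8) ^ k`, and `e ^ 2 < 8`. -/
theorem pow_div_factorial_le {x : ℝ} (hx : 0 ≤ x) {k : ℕ} (h : 8 * x ≤ k) :
    x ^ k / k.factorial ≤ Real.exp (-k) := by
  have h1 : (k : ℝ) ^ k / k.factorial ≤ Real.exp k :=
    Real.pow_div_factorial_le_exp _ (Nat.cast_nonneg k) k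
  have he : Real.exp 1 ≤ 8 * Real.exp (-1) := by
    rw [Real.exp_neg, ← div_eq_mul_inv, le_div_iff₀ (Real.exp_pos _)]
    nlinarith [Real.exp_one_lt_d9, Real.exp_one_gt_d9]
  calc x ^ k / k.factorial ≤ (k / 8 : ℝ) ^ k / k.factorial := by
        gcongr
        linarith
    _ = (1 / 8 : ℝ) ^ k * ((k : ℝ) ^ k / k.factorial) := by
        rw [div_pow, div_pow, one_pow]
        ring
    _ ≤ (1 / 8 : ℝ) ^ k * Real.exp k := by gcongr
    _ = (1 / 8 * Real.exp 1) ^ k := by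
        rw [mul_pow, ← Real.exp_nat_mul, mul_one]
    _ ≤ (Real.exp (-1)) ^ k := by
        gcongr
        linarith
    _ = _ := by
        rw [← Real.exp_nat_mul]
        ring_nf

end Numerics

/-! ### The union bound over the failure events and the constants -/

section Whp

open scoped Classical

variable {V : Type*} [Fintype V] {N : ℕ} {c : ℝ} {W : Network V N} {ω : V × ℕ → unitInterval}

theorem haltedBy_and_messageCount_le (hS : (sampledSet c ω).ncard ≤ stage V) {Δ j : ℕ}
    (hΔ : ∀ v ∈ leftover c W ω, {w ∈ leftover c W ω | W.graph.Adj v w}.ncard ≤ Δ)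
    (hj : lubyLeftover c W j ω = ∅) :
    (algorithm c).HaltedBy W 2 ω (lubyStart V + 3 * j) ∧
      (algorithm c).messageCount W 2 ω (lubyStart V + 3 * j) ≤
        3 * stage V * Fintype.card V + 3 * j * (Fintype.card V * Δ) := by
  rw [← remnant_eq_leftover hS] at hΔ
  rw [lubyLeftover, ← remnant_eq_leftover hS] at hj
  exact ⟨haltedBy_iff.2 hj, messageCount_lubyStart_add_le hS hΔ (3 * j)⟩

variable (c W) in
/-- The event that the bounds of the theorem hold with constant `K`. -/
def boundsEvent (K : ℝ) : Set (V × ℕ → unitInterval) :=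
  {ω | (∃ T : ℕ, (algorithm c).HaltedBy W 2 ω T ∧
      (T : ℝ) ≤ K * Real.sqrt (Fintype.card V) * Real.log (Fintype.card V) ^ 1 ∧
      ((algorithm c).messageCount W 2 ω T : ℝ) ≤
        K * (Fintype.card V : ℝ) ^ (1.5 : ℝ) * Real.log (Fintype.card V) ^ 2) ∧
    ∀ v ∈ remnant c W ω, ({w ∈ remnant c W ω | W.graph.Adj v w}.ncard : ℝ) ≤
      K * Real.sqrt (Fintype.card V) * Real.log (Fintype.card V)}

/-- For bounded `n` the worst case is good enough: `n` phases and `n ^ 2` messages per round. The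
constant `40` is twice the `20` of the round bound, because `log n` may be as small as about `1 /
2`. -/
theorem boundsEvent_eq_univ {K X : ℝ} (hn : 2 ≤ Fintype.card V) (hX : (Fintype.card V : ℝ) ≤ X)
    (hK : 40 * X ^ 2 ≤ K) : boundsEvent c W K = Set.univ := by
  refine Set.eq_univ_of_forall fun ω => ?_
  have hL := stageLength_le hn
  have hl := half_le_log hn
  have hs := one_le_sqrt hn
  have hsl := one_le_two_mul_sqrt_mul_log hn
  have hT : ((lubyStart V + 3 * Fintype.card V : ℕ) : ℝ) ≤
      20 * Fintype.card V * (Real.sqrt (Fintype.card V) * Real.log (Fintype.card V)) := by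
    have hn' : (2 : ℝ) ≤ Fintype.card V := by exact_mod_cast hn
    push_cast
    nlinarith
  have hM : ((algorithm c).messageCount W 2 ω (lubyStart V + 3 * Fintype.card V) : ℝ) ≤
      ((lubyStart V + 3 * Fintype.card V : ℕ) : ℝ) * (Fintype.card V : ℝ) ^ 2 := by
    exact_mod_cast messageCount_le _
  have hdeg : ∀ v, ({w ∈ remnant c W ω | W.graph.Adj v w}.ncard : ℝ) ≤ Fintype.card V := fun v => by
    have := Set.ncard_le_card {w ∈ remnant c W ω | W.graph.Adj v w}
    rw [Nat.card_eq_fintype_card] at this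
    exact_mod_cast this
  have hn' : (2 : ℝ) ≤ Fintype.card V := by exact_mod_cast hn
  refine ⟨⟨_, haltedBy_card, hT.trans ?_, hM.trans ?_⟩, fun v _ => (hdeg v).trans ?_⟩
  · rw [pow_one, mul_assoc K]
    refine mul_le_mul_of_nonneg_right ?_ (by linarith)
    nlinarith
  · rw [rpow_three_halves]
    generalize (Fintype.card V : ℝ) = n at *
    generalize Real.log n = l at *
    generalize Real.sqrt n = s at *
    have h1 : 20 * n ^ 2 ≤ K * l := by nlinarith
    have h2 : 0 ≤ n * s * l := by positivity
    calc _ ≤ 20 * n * (s * l) * n ^ 2 := by gcongr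
      _ = (20 * n ^ 2) * (n * s * l) := by ring
      _ ≤ (K * l) * (n * s * l) := by gcongr
      _ = _ := by ring
  · rw [mul_assoc]
    nlinarith

/-- Three failures are possible: too many sampled nodes, a leftover node of large degree, or Luby's
algorithm being slow. Each has probability at most `n ^ (-(a + 2))`, and `3 ≤ n ^ 2`. The lower
bound `hX` on `n` gives `8 c ≤ log n` and `a + 2 ≤ √n`, which the estimate of the sample size needs.
-/
theorem le_tapeMeasure_real_boundsEvent (hc : 0 < c) {a K J D : ℝ} (ha : 1 ≤ a)
    (hn : 2 ≤ Fintype.card V) (hX : Real.exp (8 * c) + (a + 2) ^ 2 ≤ Fintype.card V)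
    (hJ : J = 16 * (a + 4) + 4) (hD : D = (a + 3) / c + 2)
    (hK : 36 + 3 * J + 3 * J * D + D ≤ K) :
    1 - (Fintype.card V : ℝ) ^ (-a) ≤ (tapeMeasure V).real (boundsEvent c W K) := by
  have hL := stageLength_le hn
  have hL' := le_stageLength hn
  have hl := half_le_log hn
  have hs := one_le_sqrt hn
  have hsl := one_le_two_mul_sqrt_mul_log hn
  have hn' : (2 : ℝ) ≤ Fintype.card V := by exact_mod_cast hn
  have hssq : Real.sqrt (Fintype.card V) * Real.sqrt (Fintype.card V) = Fintype.card V :=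
    Real.mul_self_sqrt (Nat.cast_nonneg _)
  have hsa : a + 2 ≤ Real.sqrt (Fintype.card V) :=
    Real.le_sqrt_of_sq_le (by linarith [Real.exp_pos (8 * c)])
  have hlc : 8 * c ≤ Real.log (Fintype.card V) := by
    rw [Real.le_log_iff_exp_le (by linarith)]
    nlinarith
  have hexp := rpow_neg_eq_exp hn
  set n : ℝ := (Fintype.card V : ℝ) with hnV
  set s := Real.sqrt n
  set l := Real.log n
  -- Chosen so that `c / √n * d ≥ (a + 3) log n`; the union bound over `n` nodes costs one power of
  -- `n`.
  set d : ℕ := ⌈(a + 3) / c * (s * l)⌉₊ with hd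
  -- Since `15 / 16 ≤ exp (-1 / 16)`, this gives `(15 / 16) ^ j ≤ n ^ (-(a + 4))`; the at most `n ^
  -- 2` initial darts cost two powers of `n`.
  set j : ℕ := ⌈16 * (a + 4) * l⌉₊ with hj
  have hac : 0 ≤ (a + 3) / c := by positivity
  have hd1 : (a + 3) / c * (s * l) ≤ d := Nat.le_ceil _
  have hd2 : (d : ℝ) ≤ D * (s * l) := by
    have := (Nat.ceil_lt_add_one (mul_nonneg hac (by linarith : 0 ≤ s * l))).le
    rw [hD, add_mul]
    linarith
  have hj1 : 16 * (a + 4) * l ≤ j := Nat.le_ceil _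
  have hj2 : ((j + 1 : ℕ) : ℝ) ≤ J * l := by
    have := (Nat.ceil_lt_add_one (by positivity : 0 ≤ 16 * (a + 4) * l)).le
    push_cast
    rw [hJ]
    linarith
  have hn2 : n ^ 2 = Real.exp (2 * l) := by
    rw [show (2 : ℝ) * l = ((2 : ℕ) : ℝ) * l by norm_num, Real.exp_nat_mul,
      Real.exp_log (by linarith)]
  have hJ0 : 0 ≤ J := by rw [hJ]; linarith
  have hD0 : 0 ≤ D := by rw [hD]; linarith
  let B₁ : Set (V × ℕ → unitInterval) := {ω | stage V ≤ (sampledSet c ω).ncard}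
  let B₂ (v : V) : Set (V × ℕ → unitInterval) :=
    {ω | v ∈ leftover c W ω ∧ d ≤ {w ∈ leftover c W ω | W.graph.Adj v w}.ncard}
  let B₃ : Set (V × ℕ → unitInterval) := {ω | lubyLeftover c W (j + 1) ω ≠ ∅}
  have hcover : (Set.univ : Set (V × ℕ → unitInterval)) ⊆
      boundsEvent c W K ∪ (B₁ ∪ ((⋃ v, B₂ v) ∪ B₃)) := by
    intro ω _
    by_contra hω
    simp only [Set.mem_union, Set.mem_iUnion, not_or, not_exists] at hω
    obtain ⟨hgood, h1, h2, h3⟩ := hω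
    have hS : (sampledSet c ω).ncard ≤ stage V := (not_le.1 h1).le
    have hΔ : ∀ v ∈ leftover c W ω, {w ∈ leftover c W ω | W.graph.Adj v w}.ncard ≤ d :=
      fun v hv => (not_le.1 fun h => h2 v ⟨hv, h⟩).le
    obtain ⟨hH, hM⟩ := haltedBy_and_messageCount_le hS hΔ (not_not.1 h3)
    have hM' : ((algorithm c).messageCount W 2 ω (lubyStart V + 3 * (j + 1)) : ℝ) ≤
        3 * stage V * n + 3 * ((j + 1 : ℕ) : ℝ) * (n * d) := by
      rw [hnV]
      exact_mod_cast hM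
    refine hgood ⟨⟨_, hH, ?_, hM'.trans ?_⟩, fun v hv => ?_⟩
    · rw [pow_one]
      push_cast
      push_cast at hj2
      have : J * l ≤ J * (s * l) := by
        refine mul_le_mul_of_nonneg_left ?_ hJ0
        nlinarith
      have hJD : 0 ≤ 3 * J * D := by positivity
      -- Two stages contribute `12`, the additional round at most `2`, and the phases `3 * J`.
      have hK' : (14 + 3 * J) * (s * l) ≤ K * (s * l) :=
        mul_le_mul_of_nonneg_right (by linarith) (by linarith)
      change 2 * (stageLength (Fintype.card V) : ℝ) + 1 + 3 * ((j : ℝ) + 1) ≤ K * s * l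
      linarith
    · rw [rpow_three_halves]
      change _ ≤ K * (n * s) * l ^ 2
      have h4 : 3 * (stage V : ℝ) * n ≤ 36 * (n * s * l ^ 2) := by
        calc 3 * (stage V : ℝ) * n ≤ 3 * (6 * (s * l)) * n := by gcongr
          _ = 18 * (n * s * l) * 1 := by ring
          _ ≤ 18 * (n * s * l) * (2 * l) := by
            gcongr
            linarith
          _ = _ := by ring
      have h5 : 3 * ((j + 1 : ℕ) : ℝ) * (n * d) ≤ 3 * J * D * (n * s * l ^ 2) := by
        calc 3 * ((j + 1 : ℕ) : ℝ) * (n * d) ≤ 3 * (J * l) * (n * (D * (s * l))) := by gcongr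
          _ = _ := by ring
      have h6 : (36 + 3 * J * D) * (n * s * l ^ 2) ≤ K * (n * s * l ^ 2) := by
        gcongr
        linarith
      linarith
    · rw [remnant_eq_leftover hS] at hv ⊢
      have h4 : ({w ∈ leftover c W ω | W.graph.Adj v w}.ncard : ℝ) ≤ d := by
        exact_mod_cast hΔ v hv
      have hJD : 0 ≤ 3 * J * D := by positivity
      have h5 : D * (s * l) ≤ K * (s * l) :=
        mul_le_mul_of_nonneg_right (by linarith) (by linarith)
      change _ ≤ K * s * l
      linarith
  have hB₁ : (tapeMeasure V).real B₁ ≤ Real.exp (-((a + 2) * l)) := by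
    have hcs : n * (c / s) = c * s := by
      rw [← hssq]
      field_simp
    refine (tapeMeasure_real_le_ncard_sampledSet_le hc _).trans ?_
    rw [← hnV, show Real.sqrt n = s from rfl, hcs]
    refine (pow_div_factorial_le (by positivity) ?_).trans ?_
    · change 8 * (c * s) ≤ (stageLength (Fintype.card V) : ℝ)
      nlinarith
    · refine Real.exp_le_exp.2 (neg_le_neg ?_)
      change (a + 2) * l ≤ (stageLength (Fintype.card V) : ℝ)
      nlinarith
  have hB₂ : ∀ v, (tapeMeasure V).real (B₂ v) ≤ Real.exp (-((a + 3) * l)) := by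
    intro v
    refine (tapeMeasure_real_leftover_le v d).trans (Real.exp_le_exp.2 (neg_le_neg ?_))
    change (a + 3) * l ≤ c / s * d
    calc (a + 3) * l = c / s * ((a + 3) / c * (s * l)) := by field_simp
      _ ≤ _ := by gcongr
  have hB₃ : (tapeMeasure V).real B₃ ≤ Real.exp (-((a + 2) * l)) := by
    refine (tapeMeasure_real_lubyLeftover_ne_empty_le j).trans ?_
    have h1 : (15 / 16 : ℝ) ^ j ≤ Real.exp (-((a + 4) * l)) := by
      have h2 : (15 / 16 : ℝ) ≤ Real.exp (-(1 / 16)) := by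
        linarith [Real.add_one_le_exp (-(1 / 16) : ℝ)]
      refine (pow_le_pow_left₀ (by norm_num) h2 j).trans ?_
      rw [← Real.exp_nat_mul]
      refine Real.exp_le_exp.2 ?_
      linarith
    rw [← hnV, hn2]
    calc _ ≤ Real.exp (-((a + 4) * l)) * Real.exp (2 * l) := by gcongr
      _ = _ := by
        rw [← Real.exp_add]
        ring_nf
  have hsum : (tapeMeasure V).real (⋃ v, B₂ v) ≤ Real.exp (-((a + 2) * l)) := by
    refine (measureReal_iUnion_fintype_le B₂).trans
      ((Finset.sum_le_card_nsmul _ _ _ fun v _ => hB₂ v).trans (le_of_eq ?_))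
    rw [Finset.card_univ, nsmul_eq_mul, ← hnV]
    nth_rewrite 1 [← Real.exp_log (show 0 < n by linarith)]
    rw [← Real.exp_add]
    change Real.exp (l + _) = _
    ring_nf
  have hfinal : 3 * Real.exp (-((a + 2) * l)) ≤ n ^ (-a) := by
    rw [hexp]
    have : Real.exp (-(a * l)) = n ^ 2 * Real.exp (-((a + 2) * l)) := by
      rw [hn2, ← Real.exp_add]
      ring_nf
    rw [this]
    gcongr
    nlinarith
  have h := measureReal_mono (μ := tapeMeasure V) hcover (measure_ne_top _ _)
  rw [probReal_univ] at h
  have h1 := measureReal_union_le (μ := tapeMeasure V) (boundsEvent c W K)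
    (B₁ ∪ ((⋃ v, B₂ v) ∪ B₃))
  have h2 := measureReal_union_le (μ := tapeMeasure V) B₁ ((⋃ v, B₂ v) ∪ B₃)
  have h3 := measureReal_union_le (μ := tapeMeasure V) (⋃ v, B₂ v) B₃
  linarith

end Whp

end KT2MIS

theorem mainTheorem4 (c : ℝ) (hc : 0 < c) :
    -- messages have `O(log n)` bits if the ID space has polynomial size
    (∀ κ : ℕ, ∃ B : ℝ, ∀ (n N : ℕ) (W : Network (Fin n) N), N ≤ n ^ κ →
      ∀ (ω : Fin n × ℕ → unitInterval) (t : ℕ) (v w : Fin n) (m : Message N),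
        (KT2MIS.algorithm c).sent W 2 ω t v w = some m → (m.bits : ℝ) ≤ B * Real.log n) ∧
    -- the algorithm always terminates, with a maximal independent set
    (∀ (n N : ℕ) (W : Network (Fin n) N) (ω : Fin n × ℕ → unitInterval),
      (∃ T, (KT2MIS.algorithm c).HaltedBy W 2 ω T) ∧
      ∀ T, (KT2MIS.algorithm c).HaltedBy W 2 ω T →
        Maximal W.graph.IsIndepSet ((KT2MIS.algorithm c).outputSet W 2 ω T)) ∧
    -- with high probability, the bounds on messages, rounds and the remnant degree hold
    (∃ e : ℕ, ∀ a : ℝ, 1 ≤ a → ∃ K : ℝ, ∀ (n N : ℕ) (W : Network (Fin n) N), 2 ≤ n →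
      1 - (n : ℝ) ^ (-a) ≤ (tapeMeasure (Fin n)).real
        {ω | (∃ T : ℕ, (KT2MIS.algorithm c).HaltedBy W 2 ω T ∧
              (T : ℝ) ≤ K * Real.sqrt n * Real.log n ^ e ∧
              ((KT2MIS.algorithm c).messageCount W 2 ω T : ℝ) ≤
                K * (n : ℝ) ^ (1.5 : ℝ) * Real.log n ^ 2) ∧
            ∀ v ∈ KT2MIS.remnant c W ω,
              ({w ∈ KT2MIS.remnant c W ω | W.graph.Adj v w}.ncard : ℝ) ≤
                K * Real.sqrt n * Real.log n}) := by
  refine ⟨fun κ => ⟨(4 + κ) * (2 / Real.log 2), fun n N W hN ω t v w m h => KT2MIS.bits_le hN h⟩,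
    fun n N W ω => ⟨⟨_, KT2MIS.haltedBy_card⟩, fun T hT => KT2MIS.maximal_isIndepSet_outputSet hT⟩,
    1, fun a ha => ?_⟩
  set X := Real.exp (8 * c) + (a + 2) ^ 2 with hX
  set J := 16 * (a + 4) + 4 with hJ
  set D := (a + 3) / c + 2 with hD
  have hJ0 : 0 ≤ J := by linarith
  have hD0 : 0 ≤ D := by positivity
  -- The first summand covers `n ≤ X`, the others cover `n ≥ X`.
  refine ⟨40 * X ^ 2 + (36 + 3 * J + 3 * J * D + D), fun n N W hn => ?_⟩
  have hn' : 2 ≤ Fintype.card (Fin n) := by rwa [Fintype.card_fin]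
  suffices h : 1 - (Fintype.card (Fin n) : ℝ) ^ (-a) ≤ (tapeMeasure (Fin n)).real
      (KT2MIS.boundsEvent c W (40 * X ^ 2 + (36 + 3 * J + 3 * J * D + D))) by
    simpa only [KT2MIS.boundsEvent, Fintype.card_fin] using h
  rcases le_total X (Fintype.card (Fin n)) with h | h
  · exact KT2MIS.le_tapeMeasure_real_boundsEvent hc ha hn' h hJ hD
      (le_add_of_nonneg_left (by positivity))
  · rw [KT2MIS.boundsEvent_eq_univ hn' h (le_add_of_nonneg_right (by positivity)), probReal_univ]
    exact sub_le_self _ (by positivity)
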